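/- Let $n\ge 2$ be an integer. For a unit vector $\mathbf u\in\mathbb R^n$ (Euclidean norm $\|\cdot\|$) and $q\ge 0$, put $\mathcal C_{\mathbf u}(e^q)=\{\mathbf x\in\mathbb R^n:\ \|\mathbf x\|\le 1,\ |\mathbf x\cdot\mathbf u|\le e^{-q}\}$. For $j=1,\dots,n$ let $L_{\mathbf u,j}(q)$ be the smallest real number $L\ge 0$ such that $e^L\mathcal C_{\mathbf u}(e^q)$ contains at least $j$ linearly independent points of $\mathbb Z^n$, and let $\mathbf L_{\mathbf u}(q)=(L_{\mathbf u,1}(q),\dots,L_{\mathbf u,n}(q))$. For $\delta>0$ and $s\in\{1,2,3,\dots\}\cup\{\infty\}$, a canvas of mesh $\delta$ and cardinality $s$ in $\mathbb R^n$ consists of points $\mathbf a^{(i)}=(a^{(i)}_1,\dots,a^{(i)}_n)\in\mathbb R^n$ and integers $k_i,\ell_i$ $(0\le i<s)$ such that, for each $i$ with $0\le i<s$: (C1) $a^{(i)}_1<\dots<a^{(i)}_n$ are positive integer multiples of $\delta$; (C2) $1\le k_0\le\ell_0=n$, and $1\le k_i<\ell_i\le n$ if $i\ge1$; (C3) if $i+1<s$,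 then $k_i\le\ell_{i+1}$, $a^{(i)}_{\ell_{i+1}}+\delta\le a^{(i+1)}_{\ell_{i+1}}$, and $(a^{(i)}_1,\dots,\widehat{a^{(i)}_{k_i}},\dots,a^{(i)}_n)=(a^{(i+1)}_1,\dots,\widehat{a^{(i+1)}_{\ell_{i+1}}},\dots,a^{(i+1)}_n)$, where a hat means that the coordinate is omitted. Put $q_i=a^{(i)}_1+\dots+a^{(i)}_n$ for $0\le i<s$, and $q_s=\infty$ if $s<\infty$. The rigid $n$-system with mesh $\delta$ attached to the canvas is the function $\mathbf P\colon[q_0,\infty)\to\mathbb R^n$ such that, for $0\le i<s$ and $q_i\le q<q_{i+1}$, the $n$-tuple $\mathbf P(q)$ lists in increasing order the $n-1$ numbers $a^{(i)}_j$ $(j\ne k_i)$ and the number $a^{(i)}_{k_i}+q-q_i$. **Theorem.** Let $\delta\ge 4+(n+3)\log 2$ and let $\mathbf P\colon[q_0,\infty)\to\mathbb R^n$ be a rigid $n$-system with mesh $\delta$. Then there exists a unit vector $\mathbf u\in\mathbb R^n$ such that $$\sup_{q\ge q_0}\|\mathbf P(q)-\mathbf L_{\mathbf u}(q)\|_\infty\le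 n\log(8e^4n).$$ -/

import Mathlib

namespace RigidSystem

/-! ### Successive minima of the convex bodies attached to a vector -/

/-- The integer point `x ∈ ℤⁿ` seen in Euclidean space `ℝⁿ`. -/
def intPoint {n : ℕ} (x : Fin n → ℤ) : EuclideanSpace ℝ (Fin n) :=
  WithLp.toLp 2 (fun i => (x i : ℝ))

/-- The convex body `C_u(Q) = {x ∈ ℝⁿ ; ‖x‖ ≤ 1, |x · u| ≤ Q⁻¹}` (Euclidean norm). -/
def convexBody {n : ℕ} (u : EuclideanSpace ℝ (Fin n)) (Q : ℝ) : Set (EuclideanSpace ℝ (Fin n)) :=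
  {x | ‖x‖ ≤ 1 ∧ |inner ℝ x u| ≤ Q⁻¹}

open scoped Pointwise in
/-- The real numbers `L ≥ 0` such that `e^L C_u(e^q)` contains at least `j` linearly independent
points of `ℤⁿ`. -/
def admissibleExponents {n : ℕ} (u : EuclideanSpace ℝ (Fin n)) (j : ℕ) (q : ℝ) : Set ℝ :=
  {L | 0 ≤ L ∧ ∃ x : Fin j → (Fin n → ℤ),
    LinearIndependent ℝ (fun m => intPoint (x m)) ∧
    ∀ m, intPoint (x m) ∈ Real.exp L • convexBody u (Real.exp q)}

/-- The map `L_u = (L_{u,1}, …, L_{u,n})`.  Coordinates are numbered from `0`, so that the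
coordinate `j : Fin n` is `L_{u,j+1}(q)`, the smallest `L ≥ 0` such that `e^L C_u(e^q)` contains
at least `j + 1` linearly independent integer points. -/
noncomputable def minimaMap {n : ℕ} (u : EuclideanSpace ℝ (Fin n)) (q : ℝ) : Fin n → ℝ :=
  fun j => sInf (admissibleExponents u (j + 1) q)

/-! ### Canvases and rigid systems -/

/-- The map `Φₙ`, which lists the coordinates of a point in monotone increasing order. -/
noncomputable def sortCoords {n : ℕ} (x : Fin n → ℝ) : Fin n → ℝ :=
  x ∘ Tuple.sort x

/-- The `(n-1)`-tuple obtained from the `n`-tuple `a` by omitting its coordinate of index `k`. -/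
def omitCoord {n : ℕ} (a : Fin n → ℝ) (k : Fin n) : Fin (n - 1) → ℝ :=
  fun j => if (j : ℕ) < k then a ⟨j, by omega⟩ else a ⟨j + 1, by omega⟩

/-- A canvas with mesh `δ` in `ℝⁿ`, of cardinality `s ∈ {1, 2, 3, …, ∞}`.  The sequences are
indexed by `i ∈ ℕ`, but only their terms with `i < s` are relevant.  Coordinates are numbered
from `0`, so that `k i` and `l i` are one less than the usual indices `k_i, ℓ_i ∈ {1, …, n}`. -/
structure Canvas (n : ℕ) (δ : ℝ) where
  /-- the cardinality -/
  s : ℕ∞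
  /-- the sequence of points -/
  a : ℕ → Fin n → ℝ
  /-- the sequence of indices `k_i` -/
  k : ℕ → Fin n
  /-- the sequence of indices `ℓ_i` -/
  l : ℕ → Fin n
  mesh_pos : 0 < δ
  one_le_s : 1 ≤ s
  /-- the coordinates of each point are strictly increasing -/
  strictMono_a : ∀ i : ℕ, (i : ℕ∞) < s → StrictMono (a i)
  /-- the coordinates are positive integer multiples of the mesh -/
  multiple_a : ∀ i : ℕ, (i : ℕ∞) < s → ∀ j, ∃ m : ℕ, 0 < m ∧ a i j = m * δ
  /-- `ℓ_0 = n`; the inequalities `1 ≤ k_0 ≤ n` hold as `k 0 : Fin n` -/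
  l_zero : (l 0 : ℕ) + 1 = n
  /-- `k_i < ℓ_i` for `i ≥ 1` -/
  k_lt_l : ∀ i : ℕ, 1 ≤ i → (i : ℕ∞) < s → k i < l i
  /-- `k_i ≤ ℓ_{i+1}` -/
  k_le_l_succ : ∀ i : ℕ, ((i + 1 : ℕ) : ℕ∞) < s → k i ≤ l (i + 1)
  /-- the coordinate of index `ℓ_{i+1}` grows by at least the mesh -/
  add_mesh_le : ∀ i : ℕ, ((i + 1 : ℕ) : ℕ∞) < s → a i (l (i + 1)) + δ ≤ a (i + 1) (l (i + 1))
  /-- apart from one coordinate, consecutive points agree -/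
  omit_eq : ∀ i : ℕ, ((i + 1 : ℕ) : ℕ∞) < s →
    omitCoord (a i) (k i) = omitCoord (a (i + 1)) (l (i + 1))

/-- The switch numbers `q_i = a^{(i)}_1 + ⋯ + a^{(i)}_n` of a canvas (for `i < s`). -/
def Canvas.switch {n : ℕ} {δ : ℝ} (C : Canvas n δ) (i : ℕ) : ℝ :=
  ∑ j, C.a i j

/-- `P`, restricted to `[q₀, ∞)`, is the rigid `n`-system with mesh `δ` attached to some canvas:
`q₀` is the first switch number and, for `0 ≤ i < s` and `q_i ≤ q < q_{i+1}` (where `q_s = ∞`),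
`P q` lists in increasing order the numbers `a^{(i)}_j` with `j ≠ k_i` together with the number
`a^{(i)}_{k_i} + q - q_i`.  The values of `P` to the left of `q₀` are irrelevant. -/
def IsRigidSystem (n : ℕ) (δ q₀ : ℝ) (P : ℝ → Fin n → ℝ) : Prop :=
  ∃ C : Canvas n δ, C.switch 0 = q₀ ∧
    ∀ i : ℕ, (i : ℕ∞) < C.s → ∀ q : ℝ, C.switch i ≤ q →
      (((i + 1 : ℕ) : ℕ∞) < C.s → q < C.switch (i + 1)) →
      P q = sortCoords (Function.update (C.a i) (C.k i) (C.a i (C.k i) + q - C.switch i))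

end RigidSystem

/-!
A point `x ∈ ℤⁿ` belongs to `e^L C_u(e^q)` as soon as `‖x‖ ≤ e^L` and `|x · u| ≤ e^(L-q)`. So it is
enough to find a unit vector `u` and, for each index `i` of the canvas, linearly independent
integer points `x_1, …, x_n` such that, up to constant factors, `‖x_j‖ ≤ e^(a_j)` for all `j`,
`|x_j · u| ≤ e^(a_j - q_{i+1})` for `j ≠ k_i`, and `|x_{k_i} · u| ≤ e^(a_{k_i} - q_i)`. On
`[q_i, q_{i+1})` these points bound each `L_{u,j}(q)` from above by `P_j(q) + log 4`. The sum of the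
`P_j(q)` is `q`, and that of the `L_{u,j}(q)` is at least `q - n log √2` (`le_sum_minimaMap`, the
easy half of Minkowski's second theorem), so the upper bounds yield lower bounds:
`norm_sortCoords_sub_minimaMap_le`.

The points of stage `i` form a basis of `ℤⁿ` in which the points other than `x_{k_i}` are nearly
orthogonal; `u_i` is the unit normal of the hyperplane that they span. To pass to the next stage,
`x_{k_i}` is replaced by its sum with an integer combination of the smaller points
(`GoodSystem.exists_step`). The combination is chosen so that the new point has norm about
`e^(a')`, where `a'` is its prescribed level, and is nearly orthogonal to all the smaller points
but the one removed next. Near orthogonality is recorded by dual vectors. Replacing a point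
disturbs those of the larger points, and the difficulty is that this may happen infinitely often.
The disturbance is proportional to the product of the dual vector with the point being removed,
and this product, relative to its natural size, shrinks by a large constant factor at each stage,
since `2^n e^(-δ)` is small. Hence the total disturbance is bounded; the field
`GoodSystem.dual_add_le` expresses this as an inequality that is preserved.

The product `u_i · x_{k_i}` is controlled without any loss of constants, because the basis keeps
the determinant `±1` (`GoodSystem.abs_inner_normal_le`). It follows that the distance between `u_i`
and `u_{i+1}` is at most `2^(n+1) e^(-q_{i+1})`. So the `u_i` converge, and their limit is the
required vector `u` (`Canvas.exists_unit_vector`).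
-/

namespace RigidSystem

/-! ### Determinants, projections and integer points -/

/-- Hadamard's inequality. -/
lemma abs_det_le_prod_norm {n : ℕ} (A : Fin n → EuclideanSpace ℝ (Fin n)) :
    |(Matrix.of fun i j => A i j).det| ≤ ∏ i, ‖A i‖ := by
  have : Fact (Module.finrank ℝ (EuclideanSpace ℝ (Fin n)) = n) := ⟨by simp⟩
  let b := EuclideanSpace.basisFun (Fin n) ℝ
  refine le_trans (le_of_eq ?_) (b.toBasis.orientation.abs_volumeForm_apply_le A)
  rw [b.toBasis.orientation.volumeForm_robust b rfl, Module.Basis.det_apply, ← Matrix.det_transpose]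
  congr 2

/-- For `⟪z, x⟫ = 1` the map `f ↦ f - ⟪f, x⟫ z` is the projection onto `xᗮ` along `z`; its norm is
at most `‖x‖ ‖z‖`. Iterating this bound, rather than the triangle inequality, is what keeps the
growth in `exists_dual_vectors_above` within a factor `2` per step. -/
lemma norm_sub_inner_smul_le {E : Type*} [NormedAddCommGroup E] [InnerProductSpace ℝ E]
    {x z : E} (h : inner ℝ z x = 1) (f : E) :
    ‖f - inner ℝ f x • z‖ ≤ ‖x‖ * ‖z‖ * ‖f‖ := by
  have hx : 0 < ‖x‖ := by
    rw [norm_pos_iff]; rintro rfl; simp at h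
  set X := ‖x‖ ^ 2 with hX
  have hXp : 0 < X := by positivity
  set g := f - inner ℝ f x • z with hg
  set a := inner ℝ f x with ha
  -- `g` is the component of `f` orthogonal to `x` minus `a` times that of `z`
  have h1 : ‖f - (a / X) • x‖ ^ 2 = ‖f‖ ^ 2 - a ^ 2 / X := by
    rw [norm_sub_sq_real, inner_smul_right, norm_smul, mul_pow, ← hX, ← ha]
    simp only [Real.norm_eq_abs, sq_abs]
    field_simp
    ring
  have h2 : ‖z - X⁻¹ • x‖ ^ 2 = ‖z‖ ^ 2 - 1 / X := by
    rw [norm_sub_sq_real, inner_smul_right, norm_smul, mul_pow, ← hX, h]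
    simp only [Real.norm_eq_abs, sq_abs]
    field_simp
    ring
  have hexp : g = (f - (a / X) • x) - a • (z - X⁻¹ • x) := by
    rw [hg, smul_sub, smul_smul, div_eq_mul_inv]; abel
  have h3 : ‖g‖ ≤ ‖f - (a / X) • x‖ + |a| * ‖z - X⁻¹ • x‖ := by
    rw [hexp]
    refine (norm_sub_le _ _).trans ?_
    rw [norm_smul, Real.norm_eq_abs]
  -- Cauchy-Schwarz in the plane, applied to the two summands
  set p := ‖f - (a / X) • x‖
  set r := ‖z - X⁻¹ • x‖
  have h4 : (p + |a| * r) ^ 2 ≤ (p ^ 2 + a ^ 2 / X) * (1 + X * r ^ 2) := by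
    have : (p ^ 2 + a ^ 2 / X) * (1 + X * r ^ 2) - (p + |a| * r) ^ 2
        = (X * p * r - |a|) ^ 2 / X := by
      rw [← sq_abs a]; field_simp; ring
    have h5 : 0 ≤ (X * p * r - |a|) ^ 2 / X := by positivity
    linarith
  rw [h1, h2] at h4
  have h6 : (‖f‖ ^ 2 - a ^ 2 / X + a ^ 2 / X) * (1 + X * (‖z‖ ^ 2 - 1 / X))
      = (‖x‖ * ‖z‖ * ‖f‖) ^ 2 := by
    rw [mul_sub, mul_one_div_cancel hXp.ne']; rw [hX]; ring
  rw [h6] at h4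
  exact h3.trans (abs_le_of_sq_le_sq' h4 (by positivity)).2

lemma norm_normalize_sub_le {E : Type*} [NormedAddCommGroup E] [NormedSpace ℝ E]
    {x u : E} (hu : ‖u‖ = 1) (hx : x ≠ 0) : ‖‖x‖⁻¹ • x - u‖ ≤ 2 * ‖x - u‖ := by
  have hx' : ‖x‖ ≠ 0 := by simpa using hx
  have h1 : ‖‖x‖⁻¹ • x - x‖ = |1 - ‖x‖| := by
    have : ‖x‖⁻¹ • x - x = (‖x‖⁻¹ * (1 - ‖x‖)) • x := by
      rw [mul_sub, inv_mul_cancel₀ hx', mul_one, sub_smul, one_smul]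
    rw [this, norm_smul, norm_mul, norm_inv, norm_norm, Real.norm_eq_abs]
    field_simp
  have h2 : |1 - ‖x‖| ≤ ‖x - u‖ := by
    rw [← hu, abs_sub_comm]; exact abs_norm_sub_norm_le x u
  calc ‖‖x‖⁻¹ • x - u‖ = ‖(‖x‖⁻¹ • x - x) + (x - u)‖ := by congr 1; abel
    _ ≤ ‖‖x‖⁻¹ • x - x‖ + ‖x - u‖ := norm_add_le _ _
    _ ≤ 2 * ‖x - u‖ := by linarith

/-- Rounding the coefficients of `w` to integers. -/
lemma exists_int_combination_near {E ι : Type*} [NormedAddCommGroup E] [NormedSpace ℝ E]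
    (s : Finset ι) (v : ι → E) {w : E} (hw : w ∈ Submodule.span ℝ (v '' s)) :
    ∃ c : ι → ℤ, ‖∑ i ∈ s, c i • v i - w‖ ≤ (1 / 2) * ∑ i ∈ s, ‖v i‖ := by
  obtain ⟨r, rfl⟩ : ∃ r : ι → ℝ, ∑ i ∈ s, r i • v i = w := by
    classical
    obtain ⟨r, hr⟩ := (Submodule.mem_span_image_finset_iff_exists_fun ℝ).1 hw
    refine ⟨fun i => if h : i ∈ s then r ⟨i, h⟩ else 0, ?_⟩
    rw [← hr, ← Finset.sum_coe_sort s]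
    exact Finset.sum_congr rfl fun i _ => by simp
  refine ⟨fun i => round (r i), ?_⟩
  rw [← Finset.sum_sub_distrib, Finset.mul_sum]
  refine (norm_sum_le _ _).trans (Finset.sum_le_sum fun i _ => ?_)
  rw [← Int.cast_smul_eq_zsmul ℝ, ← sub_smul, norm_smul, Real.norm_eq_abs, abs_sub_comm]
  exact mul_le_mul_of_nonneg_right (abs_sub_round (r i)) (norm_nonneg _)

lemma intPoint_add {n : ℕ} (x y : Fin n → ℤ) : intPoint (x + y) = intPoint x + intPoint y := by
  ext i; simp [intPoint]

lemma intPoint_sum_smul {n : ℕ} {ι : Type*} (s : Finset ι) (c : ι → ℤ) (x : ι → Fin n → ℤ) :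
    intPoint (∑ i ∈ s, c i • x i) = ∑ i ∈ s, c i • intPoint (x i) := by
  ext i; simp [intPoint]

lemma inner_intPoint {n : ℕ} (z : EuclideanSpace ℝ (Fin n)) (x : Fin n → ℤ) :
    inner ℝ z (intPoint x) = ∑ j, z j * x j := by
  simp [PiLp.inner_apply, intPoint, mul_comm]

lemma det_of_intPoint {n : ℕ} (x : Fin n → Fin n → ℤ) :
    (Matrix.of fun i j => intPoint (x i) j).det = ((Matrix.of x).det : ℝ) := by
  rw [Int.cast_det]; rfl

lemma linearIndependent_intPoint_iff {n : ℕ} (x : Fin n → Fin n → ℤ) :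
    LinearIndependent ℝ (fun i => intPoint (x i)) ↔ (Matrix.of x).det ≠ 0 := by
  rw [← Int.cast_ne_zero (α := ℝ), ← det_of_intPoint, ← isUnit_iff_ne_zero,
    ← Matrix.isUnit_iff_isUnit_det, ← Matrix.linearIndependent_rows_iff_isUnit]
  exact (LinearMap.linearIndependent_iff
    (WithLp.linearEquiv 2 ℝ (Fin n → ℝ)).toLinearMap (LinearEquiv.ker _)).symm

lemma det_inner_eq_mul {n : ℕ} (z : Fin n → EuclideanSpace ℝ (Fin n)) (x : Fin n → Fin n → ℤ) :
    (Matrix.of fun i j => inner ℝ (z i) (intPoint (x j))).det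
      = (Matrix.of fun i j => z i j).det * ((Matrix.of x).det : ℝ) := by
  rw [← det_of_intPoint, ← Matrix.det_transpose (Matrix.of fun i j => intPoint (x i) j),
    ← Matrix.det_mul]
  congr 1
  ext i j
  simp [Matrix.mul_apply, PiLp.inner_apply, mul_comm]

open scoped Matrix in
/-- Stretching by the factor `Q` in the direction of `u` maps points `y i` of `c i • C_u(Q)` to
points of norm at most `√2 * c i`; the determinant gains the factor `Q`. -/
lemma le_prod_of_linearIndependent_mem {n : ℕ} {u : EuclideanSpace ℝ (Fin n)} (hu : ‖u‖ = 1)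
    {Q : ℝ} (hQ : 0 < Q) (y : Fin n → Fin n → ℤ)
    (hy : LinearIndependent ℝ (fun i => intPoint (y i))) (c : Fin n → ℝ)
    (h1 : ∀ i, ‖intPoint (y i)‖ ≤ c i) (h2 : ∀ i, |inner ℝ (intPoint (y i)) u| ≤ c i * Q⁻¹) :
    Q ≤ ∏ i, (Real.sqrt 2 * c i) := by
  have hc : ∀ i, 0 ≤ c i := fun i => (norm_nonneg _).trans (h1 i)
  set g : Fin n → EuclideanSpace ℝ (Fin n) := fun i =>
    intPoint (y i) + ((Q - 1) * inner ℝ (intPoint (y i)) u) • u with hg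
  have hnorm : ∀ i, ‖g i‖ ≤ Real.sqrt 2 * c i := by
    intro i
    set b := inner ℝ (intPoint (y i)) u with hb
    have hsq : ‖g i‖ ^ 2 = ‖intPoint (y i)‖ ^ 2 - b ^ 2 + (Q * b) ^ 2 := by
      rw [hg]
      simp only
      rw [norm_add_sq_real, inner_smul_right, norm_smul, mul_pow, hu, ← hb]
      simp only [Real.norm_eq_abs, sq_abs]
      ring
    have hQb : |Q * b| ≤ c i := by
      rw [abs_mul, abs_of_pos hQ]
      have := mul_le_mul_of_nonneg_left (h2 i) hQ.le
      rwa [mul_comm (c i), mul_inv_cancel_left₀ hQ.ne'] at this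
    have hQb2 : (Q * b) ^ 2 ≤ c i ^ 2 := sq_le_sq' (abs_le.1 hQb).1 (abs_le.1 hQb).2
    have hy2 : ‖intPoint (y i)‖ ^ 2 ≤ c i ^ 2 := pow_le_pow_left₀ (norm_nonneg _) (h1 i) 2
    refine (abs_le_of_sq_le_sq' (?_ : ‖g i‖ ^ 2 ≤ (Real.sqrt 2 * c i) ^ 2) ?_).2
    · rw [mul_pow, Real.sq_sqrt (by norm_num)]
      nlinarith [sq_nonneg b]
    · exact mul_nonneg (Real.sqrt_nonneg _) (hc i)
  have hdet : (Matrix.of fun i j => g i j).det = ((Matrix.of y).det : ℝ) * Q := by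
    have huu : (u : Fin n → ℝ) ⬝ᵥ u = 1 := by
      have := EuclideanSpace.real_norm_sq_eq u
      rw [hu, one_pow] at this
      simp only [dotProduct, this, ← pow_two]
    have hG : (1 + Matrix.replicateCol Unit ((Q - 1) • (u : Fin n → ℝ)) *
        Matrix.replicateRow Unit (u : Fin n → ℝ)).det = Q := by
      rw [Matrix.det_one_add_replicateCol_mul_replicateRow]
      simp [dotProduct_smul, huu]
    rw [← det_of_intPoint, ← hG, ← Matrix.det_mul]
    congr 1
    ext i j
    rw [Matrix.mul_add, Matrix.mul_one]
    simp only [hg, PiLp.add_apply, PiLp.smul_apply, PiLp.inner_apply, Matrix.add_apply,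
      Matrix.mul_apply, Matrix.of_apply, Finset.mul_sum]
    simp only [Matrix.replicateCol_apply, Matrix.replicateRow_apply, Finset.sum_const,
      Finset.card_univ, Fintype.card_unit, one_smul, Pi.smul_apply, smul_eq_mul, RCLike.inner_apply,
      conj_trivial, Finset.sum_mul, add_right_inj]
    exact Finset.sum_congr rfl fun x _ => by ring
  have hne := (linearIndependent_intPoint_iff y).1 hy
  have h1le : (1 : ℝ) ≤ |((Matrix.of y).det : ℝ)| := by
    exact_mod_cast Int.one_le_abs hne
  calc Q ≤ |((Matrix.of y).det : ℝ)| * Q := le_mul_of_one_le_left hQ.le h1le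
    _ = |(Matrix.of fun i j => g i j).det| := by rw [hdet, abs_mul, abs_of_pos hQ]
    _ ≤ ∏ i, ‖g i‖ := abs_det_le_prod_norm g
    _ ≤ _ := Finset.prod_le_prod (fun i _ => norm_nonneg _) fun i _ => hnorm i

/-! ### Nearly orthogonal systems of integer points -/

/-- A stage of the construction. The indices are the real numbers of a set `S` with `n` elements:
`X α` is an integer point of norm at most `7 / 4 * e ^ α`, and `κ` is the index of the point about
to be removed. The remaining `n - 1` points span the hyperplane orthogonal to the unit vector `u`,
and they are nearly orthogonal in the sense that each `X α` has a dual vector `Z α`, of norm at most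
`e ^ (-α)`, which annihilates the smaller points. The dual vectors need not annihilate `X κ`, but
`dual_add_le` charges the size of that product against the slack in the bound on `‖Z α‖`, so that
the corrections made to `Z α` in later stages have a bounded total. Only the values of `X` on `S`,
and those of `Z` on `S \ {κ}`, matter. -/
structure GoodSystem {n : ℕ} (S : Finset ℝ) (κ : ℝ) (X : ℝ → Fin n → ℤ)
    (Z : ℝ → EuclideanSpace ℝ (Fin n)) (u : EuclideanSpace ℝ (Fin n)) : Prop where
  card_eq : S.card = n
  mem : κ ∈ S
  norm_le : ∀ α ∈ S, ‖intPoint (X α)‖ ≤ 7 / 4 * Real.exp α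
  inner_self : ∀ α ∈ S, α ≠ κ → inner ℝ (Z α) (intPoint (X α)) = 1
  inner_of_lt : ∀ α ∈ S, α ≠ κ → ∀ β ∈ S, β ≠ κ → β < α → inner ℝ (Z α) (intPoint (X β)) = 0
  dual_le : ∀ α ∈ S, α ≠ κ → ‖Z α‖ * Real.exp α ≤ 1
  dual_add_le : ∀ α ∈ S, κ < α →
    ‖Z α‖ * Real.exp α + 1 / 8 * |inner ℝ (Z α) (intPoint (X κ))| * Real.exp (α - κ) ≤ 1
  norm_normal : ‖u‖ = 1
  inner_normal : ∀ α ∈ S, α ≠ κ → inner ℝ u (intPoint (X α)) = 0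
  /-- the points form a basis of `ℤⁿ` -/
  abs_det : ∀ e : Fin n → ℝ, Function.Injective e → (∀ i, e i ∈ S) →
    |(Matrix.of fun i => X (e i)).det| = 1

namespace GoodSystem

variable {n : ℕ} {S : Finset ℝ} {κ : ℝ} {X : ℝ → Fin n → ℤ}
  {Z : ℝ → EuclideanSpace ℝ (Fin n)} {u : EuclideanSpace ℝ (Fin n)}

lemma linearIndependent (h : GoodSystem S κ X Z u) {e : Fin n → ℝ} (he : Function.Injective e)
    (heS : ∀ i, e i ∈ S) : LinearIndependent ℝ (fun i => intPoint (X (e i))) := by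
  rw [linearIndependent_intPoint_iff]
  intro h0
  have := h.abs_det e he heS
  rw [h0] at this
  simp at this

lemma linearIndepOn (h : GoodSystem S κ X Z u) :
    LinearIndepOn ℝ (fun β => intPoint (X β)) (S : Set ℝ) := by
  have h1 := h.linearIndependent (S.orderEmbOfFin h.card_eq).injective
    (fun i => S.orderEmbOfFin_mem h.card_eq i)
  rw [← S.range_orderEmbOfFin h.card_eq,
    linearIndepOn_range_iff (S.orderEmbOfFin h.card_eq).injective]
  exact h1

/-- The products of the vectors `Z α`, `u` with the points of the system form a triangular matrix
with diagonal `1, …, 1, ⟪u, X κ⟫`. The points have determinant `±1`, so `|⟪u, X κ⟫|` is the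
determinant of the vectors `Z α`, `u`, and Hadamard's inequality applies. No constant is lost,
whatever the number of stages that led to the system. -/
lemma abs_inner_normal_le (h : GoodSystem S κ X Z u) :
    |inner ℝ u (intPoint (X κ))| ≤ Real.exp (κ - ∑ α ∈ S, α) := by
  obtain _ | n := n
  · have := h.mem
    rw [Finset.card_eq_zero.1 h.card_eq] at this
    simp at this
  have hc : (S.erase κ).card = n := by rw [Finset.card_erase_of_mem h.mem, h.card_eq]; rfl
  set o := (S.erase κ).orderEmbOfFin hc with ho
  have hoS : ∀ r, o r ∈ S ∧ o r ≠ κ := fun r => by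
    have := (S.erase κ).orderEmbOfFin_mem hc r
    rw [Finset.mem_erase] at this
    exact ⟨this.2, this.1⟩
  -- the elements other than `κ` in increasing order, followed by `κ`
  set e : Fin (n + 1) → ℝ := Fin.snoc (α := fun _ => ℝ) o κ with he
  set z : Fin (n + 1) → EuclideanSpace ℝ (Fin (n + 1)) :=
    Fin.snoc (α := fun _ => EuclideanSpace ℝ (Fin (n + 1))) (fun r => Z (o r)) u with hz
  have heS : ∀ i, e i ∈ S := fun i => by
    refine Fin.lastCases ?_ (fun r => ?_) i
    · simpa [he] using h.mem
    · simpa [he] using (hoS r).1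
  have heinj : Function.Injective e := by
    rw [he, Fin.snoc_injective_iff]
    refine ⟨o.injective, ?_⟩
    rintro ⟨r, hr⟩
    exact (hoS r).2 hr
  have htri : (Matrix.of fun i j => inner ℝ (z i) (intPoint (X (e j)))).IsUpperTriangular := by
    intro i j hij
    simp only [id] at hij
    induction j using Fin.lastCases with
    | last => exact absurd hij (not_lt.2 (Fin.le_last i))
    | cast s =>
      induction i using Fin.lastCases with
      | last => simpa [he, hz] using h.inner_normal _ (hoS s).1 (hoS s).2
      | cast r =>
        have hsr : o s < o r := o.strictMono (by simpa using hij)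
        simpa [he, hz] using h.inner_of_lt _ (hoS r).1 (hoS r).2 _ (hoS s).1 (hoS s).2 hsr
  have hdet := det_inner_eq_mul z (fun i => X (e i))
  rw [Matrix.det_of_isUpperTriangular htri, Fin.prod_univ_castSucc] at hdet
  have hone : ∏ r : Fin n, (Matrix.of fun i j => inner ℝ (z i) (intPoint (X (e j))))
      r.castSucc r.castSucc = 1 :=
    Finset.prod_eq_one fun r _ => by
      simpa [he, hz] using h.inner_self _ (hoS r).1 (hoS r).2
  rw [hone, one_mul] at hdet
  have hlast : inner ℝ u (intPoint (X κ)) =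
      (Matrix.of fun i j => z i j).det * ((Matrix.of fun i => X (e i)).det : ℝ) := by
    rw [← hdet]; simp [he, hz]
  have habs : |((Matrix.of fun i => X (e i)).det : ℝ)| = 1 := by
    exact_mod_cast h.abs_det e heinj heS
  have hsum : ∑ r, o r = ∑ α ∈ S, α - κ := by
    rw [← Finset.sum_erase_eq_sub h.mem, ← Finset.sum_coe_sort (S.erase κ)]
    exact Equiv.sum_comp ((S.erase κ).orderIsoOfFin hc).toEquiv (fun x => (x : ℝ))
  rw [hlast, abs_mul, habs, mul_one]
  refine (abs_det_le_prod_norm z).trans ?_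
  rw [Fin.prod_univ_castSucc]
  have hlastz : ‖z (Fin.last n)‖ = 1 := by simpa [hz] using h.norm_normal
  rw [hlastz, mul_one, show κ - ∑ α ∈ S, α = ∑ r, -o r by rw [Finset.sum_neg_distrib, hsum]; ring,
    Real.exp_sum]
  refine Finset.prod_le_prod (fun _ _ => norm_nonneg _) fun r _ => ?_
  have := h.dual_le _ (hoS r).1 (hoS r).2
  rw [Real.exp_neg, ← one_div, le_div_iff₀ (Real.exp_pos _)]
  simpa [hz] using this

end GoodSystem

/-- A point of `x + ⟨X β ; β ∈ T⟩_ℤ` near a multiple of a unit vector `p` which is orthogonal to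
all the points `X β`, `β ∈ T`, but one. -/
lemma exists_near_orthogonal_point {n : ℕ} (X : ℝ → Fin n → ℤ) (T : Finset ℝ)
    (hT : LinearIndepOn ℝ (fun β => intPoint (X β)) (T : Set ℝ)) {κ' : ℝ} (hκ' : κ' ∈ T)
    (x : Fin n → ℤ) (t : ℝ) :
    ∃ (c : ℝ → ℤ) (p : EuclideanSpace ℝ (Fin n)), ‖p‖ = 1 ∧
      (∀ β ∈ T, β ≠ κ' → inner ℝ p (intPoint (X β)) = 0) ∧
      ‖intPoint (x + ∑ β ∈ T, c β • X β) - t • p‖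
        ≤ ‖intPoint x‖ + (1 / 2) * ∑ β ∈ T, ‖intPoint (X β)‖ := by
  classical
  set v : ℝ → EuclideanSpace ℝ (Fin n) := fun β => intPoint (X β) with hv
  set U := Submodule.span ℝ (v '' ((T.erase κ' : Finset ℝ) : Set ℝ)) with hU
  have hnot : v κ' ∉ U := by
    rw [hU, Finset.coe_erase]
    exact LinearIndepOn.notMem_span hT hκ'
  set p₀ := v κ' - U.starProjection (v κ') with hp₀
  have hp₀ne : p₀ ≠ 0 := by
    intro h0
    rw [hp₀, sub_eq_zero] at h0
    exact hnot (h0 ▸ U.starProjection_apply_mem (v κ'))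
  have hperp : ∀ w ∈ U, inner ℝ p₀ w = 0 := fun w hw =>
    U.starProjection_inner_eq_zero (v κ') w hw
  have hp₀T : p₀ ∈ Submodule.span ℝ (v '' (T : Set ℝ)) := by
    refine Submodule.sub_mem _ (Submodule.subset_span ⟨κ', hκ', rfl⟩) ?_
    refine Submodule.span_mono (Set.image_mono ?_) (U.starProjection_apply_mem (v κ'))
    exact_mod_cast T.erase_subset κ'
  obtain ⟨c, hc⟩ := exists_int_combination_near T v
    (w := t • ‖p₀‖⁻¹ • p₀) (Submodule.smul_mem _ _ (Submodule.smul_mem _ _ hp₀T))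
  refine ⟨c, ‖p₀‖⁻¹ • p₀, norm_smul_inv_norm (𝕜 := ℝ) hp₀ne, fun β hβ hne => ?_, ?_⟩
  · rw [inner_smul_left, hperp _ (Submodule.subset_span ⟨β, by simp [hβ, hne], rfl⟩), mul_zero]
  · rw [intPoint_add, intPoint_sum_smul, add_sub_assoc]
    exact (norm_add_le _ _).trans (add_le_add_right hc _)

/-- The new point `x` has a dual vector `f₀` relative to the points below it, indexed by `B`. The
dual vectors `Z γ` of the larger points are corrected, in increasing order of `γ`, so that they
annihilate `x` as well, and `f₀` is changed into a vector `f` that annihilates the larger points.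
The point `v κ` is the one removed before `x` was inserted, and `v κ'` the one removed next. -/
lemma exists_dual_vectors_above {E : Type*} [NormedAddCommGroup E] [InnerProductSpace ℝ E]
    {v Z : ℝ → E} {x f₀ : E} {κ κ' C : ℝ} (B : Finset ℝ) {m : ℕ}
    (hf₀x : inner ℝ f₀ x = 1) (hf₀B : ∀ β ∈ B, inner ℝ f₀ (v β) = 0) (hf₀ : ‖f₀‖ ≤ C)
    (hC : 2 ^ m * C * Real.exp κ ≤ 1 / 200) (hvκ' : ‖v κ'‖ ≤ 7 / 4 * Real.exp κ')
    (W : Finset ℝ) (hWm : W.card ≤ m)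
    (hvW : ∀ γ ∈ W, ‖v γ‖ ≤ 7 / 4 * Real.exp γ)
    (hself : ∀ γ ∈ W, inner ℝ (Z γ) (v γ) = 1)
    (hlow : ∀ γ ∈ W, ∀ β ∈ W, β < γ → inner ℝ (Z γ) (v β) = 0)
    (hB : ∀ γ ∈ W, ∀ β ∈ B, inner ℝ (Z γ) (v β) = 0)
    (hκ'0 : ∀ γ ∈ W, inner ℝ (Z γ) (v κ') = 0)
    (hx : ∀ γ ∈ W, inner ℝ (Z γ) x = inner ℝ (Z γ) (v κ))
    (hZ : ∀ γ ∈ W,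
      ‖Z γ‖ * Real.exp γ + 1 / 8 * |inner ℝ (Z γ) (v κ)| * Real.exp (γ - κ) ≤ 1) :
    ∃ (Y : ℝ → E) (f : E), inner ℝ f x = 1 ∧ (∀ β ∈ B, inner ℝ f (v β) = 0) ∧
      (∀ γ ∈ W, inner ℝ f (v γ) = 0) ∧ ‖f‖ ≤ 2 ^ W.card * C ∧
      ∀ γ ∈ W, inner ℝ (Y γ) (v γ) = 1 ∧ inner ℝ (Y γ) x = 0 ∧
        (∀ β ∈ B, inner ℝ (Y γ) (v β) = 0) ∧
        (∀ β ∈ W, β < γ → inner ℝ (Y γ) (v β) = 0) ∧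
        ‖Y γ‖ * Real.exp γ + 1 / 8 * |inner ℝ (Y γ) (v κ')| * Real.exp (γ - κ') ≤ 1 := by
  classical
  have hC0 : 0 ≤ C := (norm_nonneg _).trans hf₀
  induction W using Finset.induction_on_max with
  | empty => exact ⟨Z, f₀, hf₀x, hf₀B, by simp, by simpa using hf₀, by simp⟩
  | insert γ W hγ ih =>
    have hγW : γ ∉ W := fun h => lt_irrefl _ (hγ γ h)
    have hmono : ∀ β ∈ W, β ∈ insert γ W := fun β => Finset.mem_insert_of_mem
    rw [Finset.card_insert_of_notMem hγW] at hWm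
    obtain ⟨Y, f, hfx, hfB, hfW, hfn, hY⟩ := ih (by omega) (fun a ha => hvW a (hmono a ha))
      (fun a ha => hself a (hmono a ha))
      (fun a ha b hb => hlow a (hmono a ha) b (hmono b hb)) (fun a ha => hB a (hmono a ha))
      (fun a ha => hκ'0 a (hmono a ha)) (fun a ha => hx a (hmono a ha))
      (fun a ha => hZ a (hmono a ha))
    have hγm : γ ∈ insert γ W := Finset.mem_insert_self γ W
    set s := inner ℝ (Z γ) (v κ) with hs
    have hexpγ := Real.exp_pos γ
    have hexpκ := Real.exp_pos κ
    have hZγ := hZ γ hγm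
    rw [← hs, Real.exp_sub] at hZγ
    have hs8 : |s| * Real.exp γ ≤ 8 * Real.exp κ := by
      have h1 : 1 / 8 * |s| * (Real.exp γ / Real.exp κ) ≤ 1 := by
        have : 0 ≤ ‖Z γ‖ * Real.exp γ := by positivity
        linarith
      rw [← mul_div_assoc, div_le_one hexpκ] at h1
      linarith
    have hZ1 : ‖Z γ‖ * Real.exp γ ≤ 1 := by
      have : 0 ≤ 1 / 8 * |s| * (Real.exp γ / Real.exp κ) := by positivity
      linarith
    have hfκ : ‖f‖ * Real.exp κ ≤ 1 / 200 := by
      refine le_trans (mul_le_mul_of_nonneg_right (hfn.trans ?_) hexpκ.le) hC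
      exact mul_le_mul_of_nonneg_right (pow_le_pow_right₀ one_le_two (by omega)) hC0
    set b := inner ℝ f (v γ) with hb
    have hbs : |b * s| ≤ 1 / 8 := by
      have h1 : |b| ≤ ‖f‖ * (7 / 4 * Real.exp γ) :=
        (abs_real_inner_le_norm _ _).trans
          (mul_le_mul_of_nonneg_left (hvW γ hγm) (norm_nonneg _))
      rw [abs_mul]
      calc |b| * |s| ≤ ‖f‖ * (7 / 4 * Real.exp γ) * |s| :=
            mul_le_mul_of_nonneg_right h1 (abs_nonneg s)
        _ = 7 / 4 * ‖f‖ * (|s| * Real.exp γ) := by ring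
        _ ≤ 7 / 4 * ‖f‖ * (8 * Real.exp κ) := by gcongr
        _ ≤ 1 / 8 := by linarith
    have hden : 7 / 8 ≤ 1 - b * s := by linarith [(abs_le.1 hbs).2]
    have hden0 : 1 - b * s ≠ 0 := by linarith
    -- `g` annihilates `v γ` and has product `1` with `x`
    set g := (1 - b * s)⁻¹ • (f - b • Z γ) with hg
    have hgx : inner ℝ g x = 1 := by
      rw [hg, inner_smul_left, inner_sub_left, inner_smul_left, hfx, hx γ hγm, ← hs]
      simpa using inv_mul_cancel₀ hden0
    have hgγ : inner ℝ g (v γ) = 0 := by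
      rw [hg, inner_smul_left, inner_sub_left, inner_smul_left, hself γ hγm, ← hb]
      simp
    have hgB : ∀ β ∈ B, inner ℝ g (v β) = 0 := fun β hβ => by
      rw [hg, inner_smul_left, inner_sub_left, inner_smul_left, hfB β hβ, hB γ hγm β hβ]
      simp
    have hgW : ∀ β ∈ W, inner ℝ g (v β) = 0 := fun β hβ => by
      rw [hg, inner_smul_left, inner_sub_left, inner_smul_left, hfW β hβ,
        hlow γ hγm β (hmono β hβ) (hγ β hβ)]
      simp
    have hgf : ‖g‖ ≤ 2 * ‖f‖ := by
      have h1 := norm_sub_inner_smul_le (hself γ hγm) f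
      have h2 : ‖v γ‖ * ‖Z γ‖ ≤ 7 / 4 := by
        calc ‖v γ‖ * ‖Z γ‖ ≤ 7 / 4 * Real.exp γ * ‖Z γ‖ :=
              mul_le_mul_of_nonneg_right (hvW γ hγm) (norm_nonneg _)
          _ = 7 / 4 * (‖Z γ‖ * Real.exp γ) := by ring
          _ ≤ 7 / 4 := by linarith
      rw [hg, norm_smul, norm_inv, Real.norm_eq_abs, abs_of_pos (by linarith),
        inv_mul_le_iff₀ (by linarith)]
      calc ‖f - b • Z γ‖ ≤ 7 / 4 * ‖f‖ :=
            h1.trans (mul_le_mul_of_nonneg_right h2 (norm_nonneg _))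
        _ ≤ (1 - b * s) * (2 * ‖f‖) := by nlinarith [norm_nonneg f]
    refine ⟨Function.update Y γ (Z γ - s • g), g, hgx, hgB, ?_, ?_, ?_⟩
    · intro β hβ
      rcases Finset.mem_insert.1 hβ with rfl | hβ
      · exact hgγ
      · exact hgW β hβ
    · rw [Finset.card_insert_of_notMem hγW, pow_succ]
      linarith
    · intro β hβ'
      rcases Finset.mem_insert.1 hβ' with rfl | hβ
      · rw [Function.update_self]
        refine ⟨?_, ?_, fun α hα => ?_, fun α hα hlt => ?_, ?_⟩
        · rw [inner_sub_left, inner_smul_left, hgγ, hself _ hγm]; simp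
        · rw [inner_sub_left, inner_smul_left, hgx, hx _ hγm, ← hs]; simp
        · rw [inner_sub_left, inner_smul_left, hgB α hα, hB _ hγm α hα]; simp
        · rcases Finset.mem_insert.1 hα with rfl | hα
          · exact absurd hlt (lt_irrefl _)
          · rw [inner_sub_left, inner_smul_left, hgW α hα, hlow _ hγm α (hmono α hα) hlt]; simp
        · have h1 : ‖Z β - s • g‖ ≤ ‖Z β‖ + |s| * ‖g‖ := by
            refine (norm_sub_le _ _).trans_eq ?_
            rw [norm_smul, Real.norm_eq_abs]
          have h2 : |inner ℝ (Z β - s • g) (v κ')| ≤ |s| * ‖g‖ * (7 / 4 * Real.exp κ') := by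
            rw [inner_sub_left, inner_smul_left, hκ'0 β hγm, zero_sub, abs_neg, abs_mul, mul_assoc]
            refine mul_le_mul_of_nonneg_left ?_ (by simp)
            exact (abs_real_inner_le_norm _ _).trans
              (mul_le_mul_of_nonneg_left hvκ' (norm_nonneg _))
          have hexpκ' := Real.exp_pos κ'
          rw [Real.exp_sub]
          calc ‖Z β - s • g‖ * Real.exp β + 1 / 8 * |inner ℝ (Z β - s • g) (v κ')| *
                (Real.exp β / Real.exp κ')
              ≤ (‖Z β‖ + |s| * ‖g‖) * Real.exp β + 1 / 8 * (|s| * ‖g‖ * (7 / 4 * Real.exp κ')) *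
                (Real.exp β / Real.exp κ') := by gcongr
            _ = ‖Z β‖ * Real.exp β + |s| * (Real.exp β / Real.exp κ) *
                (39 / 32 * (‖g‖ * Real.exp κ)) := by field_simp; ring
            _ ≤ ‖Z β‖ * Real.exp β + |s| * (Real.exp β / Real.exp κ) * (1 / 8) := by
                gcongr
                have : ‖g‖ * Real.exp κ ≤ 2 * ‖f‖ * Real.exp κ := by gcongr
                linarith
            _ ≤ 1 := by linarith
      · have hne : β ≠ γ := fun h => hγW (h ▸ hβ)
        rw [Function.update_of_ne hne]
        obtain ⟨h1, h2, h3, h4, h5⟩ := hY β hβ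
        refine ⟨h1, h2, h3, fun α hα hlt => ?_, h5⟩
        rcases Finset.mem_insert.1 hα with rfl | hα
        · exact absurd hlt (not_lt.2 (hγ β hβ).le)
        · exact h4 α hα hlt

/-! ### Replacing a point of a system -/

/-- The passage to the next stage: a new point `x` with index `α` replaces `X κ`, and the next point
to be removed is `X κ'`, with `κ' < α`. The new normal vector is the old one, corrected along a
vector dual to `x`, and normalised. -/
theorem GoodSystem.exists_step {n : ℕ} {S : Finset ℝ} {κ : ℝ} {X : ℝ → Fin n → ℤ}
    {Z : ℝ → EuclideanSpace ℝ (Fin n)} {u : EuclideanSpace ℝ (Fin n)}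
    (h : GoodSystem S κ X Z u) {δ α κ' : ℝ} (hδ : 2 ^ n * Real.exp (-δ) ≤ 1 / 400)
    (hκα : κ < α) (hsep : ∀ β ∈ S, β < α → β + δ ≤ α) (hα : α ∉ S) (hκ' : κ' ∈ S)
    (hne : κ' ≠ κ) (hκ'α : κ' < α) (hsum : δ ≤ ∑ β ∈ insert α (S.erase κ), β) :
    ∃ (x : Fin n → ℤ) (Z' : ℝ → EuclideanSpace ℝ (Fin n)) (u' : EuclideanSpace ℝ (Fin n)),
      GoodSystem (insert α (S.erase κ)) κ' (Function.update X α x) Z' u' ∧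
      ‖u' - u‖ ≤ 2 ^ (n + 1) * Real.exp (-∑ β ∈ insert α (S.erase κ), β) := by
  set S' := insert α (S.erase κ) with hS'
  set v : ℝ → EuclideanSpace ℝ (Fin n) := fun β => intPoint (X β) with hv
  set T := S.filter (fun β => β < α ∧ β ≠ κ) with hT
  set W := S.filter (fun β => α < β) with hW
  have hTS : ∀ β ∈ T, β ∈ S ∧ β < α ∧ β ≠ κ := fun β hβ => Finset.mem_filter.1 hβ
  have hWS : ∀ β ∈ W, β ∈ S ∧ α < β := fun β hβ => Finset.mem_filter.1 hβ
  have hS'mem : ∀ β ∈ S', β = α ∨ (β ∈ T) ∨ β ∈ W := by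
    intro β hβ
    rcases Finset.mem_insert.1 hβ with rfl | hβ
    · exact Or.inl rfl
    · obtain ⟨h1, h2⟩ := Finset.mem_erase.1 hβ
      rcases lt_trichotomy β α with hlt | rfl | hlt
      · exact Or.inr (Or.inl (Finset.mem_filter.2 ⟨h2, hlt, h1⟩))
      · exact Or.inl rfl
      · exact Or.inr (Or.inr (Finset.mem_filter.2 ⟨h2, hlt⟩))
  have hcardS' : S'.card = n := by
    rw [hS', Finset.card_insert_of_notMem (fun h' => hα (Finset.mem_of_mem_erase h')),
      Finset.card_erase_of_mem h.mem, h.card_eq]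
    have : 0 < S.card := Finset.card_pos.2 ⟨κ, h.mem⟩
    have := h.card_eq
    omega
  have hsumS' : ∑ β ∈ S', β = ∑ β ∈ S, β - κ + α := by
    rw [hS', Finset.sum_insert (fun h' => hα (Finset.mem_of_mem_erase h')),
      Finset.sum_erase_eq_sub h.mem]
    ring
  have hκ'T : κ' ∈ T := Finset.mem_filter.2 ⟨hκ', hκ'α, hne⟩
  have hE := Real.exp_pos α
  -- every exponential of an element below `α` is negligible
  have hsmall : ∀ β ∈ S, β < α → Real.exp β ≤ Real.exp (-δ) * Real.exp α := by
    intro β hβ hlt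
    rw [← Real.exp_add]
    exact Real.exp_le_exp.2 (by linarith [hsep β hβ hlt])
  -- the length `3 / 2 * e ^ α` leaves room on both sides: the new point must not exceed
  -- `7 / 4 * e ^ α`, and its dual vector must have norm at most `32 / 39 * e ^ (-α)`
  obtain ⟨c, p, hp1, hpT, hnear⟩ := exists_near_orthogonal_point X T
    (h.linearIndepOn.mono (by exact_mod_cast Finset.filter_subset _ S)) hκ'T (X κ)
    (3 / 2 * Real.exp α)
  set x := X κ + ∑ β ∈ T, c β • X β with hx
  have hn1 : (n : ℝ) ≤ 2 ^ n := by exact_mod_cast (Nat.lt_two_pow_self (n := n)).le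
  have herr : ‖intPoint x - (3 / 2 * Real.exp α) • p‖ ≤ 1 / 16 * Real.exp α := by
    refine hnear.trans ?_
    have h1 : ‖intPoint (X κ)‖ ≤ 7 / 4 * (Real.exp (-δ) * Real.exp α) :=
      (h.norm_le κ h.mem).trans (mul_le_mul_of_nonneg_left (hsmall κ h.mem hκα) (by norm_num))
    have h2 : ∑ β ∈ T, ‖intPoint (X β)‖ ≤ n * (7 / 4 * (Real.exp (-δ) * Real.exp α)) := by
      calc ∑ β ∈ T, ‖intPoint (X β)‖ ≤ ∑ _β ∈ T, 7 / 4 * (Real.exp (-δ) * Real.exp α) :=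
            Finset.sum_le_sum fun β hβ => (h.norm_le β (hTS β hβ).1).trans
              (mul_le_mul_of_nonneg_left (hsmall β (hTS β hβ).1 (hTS β hβ).2.1) (by norm_num))
        _ = T.card * (7 / 4 * (Real.exp (-δ) * Real.exp α)) := by
            rw [Finset.sum_const, nsmul_eq_mul]
        _ ≤ _ := by
            gcongr
            exact (Finset.card_filter_le _ _).trans_eq h.card_eq
    have h3 : n * Real.exp (-δ) ≤ 1 / 400 :=
      (mul_le_mul_of_nonneg_right hn1 (Real.exp_pos _).le).trans hδ
    have h4 : Real.exp (-δ) ≤ 1 / 400 :=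
      (le_mul_of_one_le_left (Real.exp_pos _).le (one_le_pow₀ one_le_two)).trans hδ
    nlinarith [mul_le_mul_of_nonneg_right h3 hE.le, mul_le_mul_of_nonneg_right h4 hE.le]
  have hxnorm : ‖intPoint x‖ ≤ 7 / 4 * Real.exp α := by
    have h1 : ‖(3 / 2 * Real.exp α) • p‖ = 3 / 2 * Real.exp α := by
      rw [norm_smul, hp1, mul_one, Real.norm_eq_abs, abs_of_pos (by positivity)]
    have := norm_le_norm_add_norm_sub' (intPoint x) ((3 / 2 * Real.exp α) • p)
    linarith
  have hpx : 23 / 16 * Real.exp α ≤ inner ℝ p (intPoint x) := by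
    have h1 : inner ℝ p (intPoint x) =
        3 / 2 * Real.exp α + inner ℝ p (intPoint x - (3 / 2 * Real.exp α) • p) := by
      rw [inner_sub_right, inner_smul_right, real_inner_self_eq_norm_sq, hp1]; ring
    have h2 := abs_real_inner_le_norm p (intPoint x - (3 / 2 * Real.exp α) • p)
    rw [hp1, one_mul] at h2
    have := (abs_le.1 h2).1
    linarith
  have hpx0 : 0 < inner ℝ p (intPoint x) := lt_of_lt_of_le (by positivity) hpx
  -- the vector dual to the new point, relative to the smaller points
  set f₀ := (inner ℝ p (intPoint x))⁻¹ • p with hf₀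
  have hf₀x : inner ℝ f₀ (intPoint x) = 1 := by
    rw [hf₀, inner_smul_left]; exact inv_mul_cancel₀ hpx0.ne'
  have hf₀T : ∀ β ∈ T.erase κ', inner ℝ f₀ (v β) = 0 := fun β hβ => by
    rw [hf₀, inner_smul_left, hpT β (Finset.mem_of_mem_erase hβ) (Finset.ne_of_mem_erase hβ),
      mul_zero]
  have hf₀n : ‖f₀‖ ≤ 16 / 23 * (Real.exp α)⁻¹ := by
    rw [hf₀, norm_smul, hp1, mul_one, norm_inv, Real.norm_eq_abs, abs_of_pos hpx0]
    refine (inv_anti₀ (by positivity) hpx).trans_eq ?_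
    rw [mul_inv]; norm_num
  have hWn : W.card ≤ n := (Finset.card_filter_le _ _).trans_eq h.card_eq
  have hC : 2 ^ n * (16 / 23 * (Real.exp α)⁻¹) * Real.exp κ ≤ 1 / 200 := by
    calc 2 ^ n * (16 / 23 * (Real.exp α)⁻¹) * Real.exp κ
        ≤ 2 ^ n * (16 / 23 * (Real.exp α)⁻¹) * (Real.exp (-δ) * Real.exp α) := by
          gcongr; exact hsmall κ h.mem hκα
      _ = 16 / 23 * (2 ^ n * Real.exp (-δ)) := by field_simp
      _ ≤ 1 / 200 := by linarith
  have hWne : ∀ γ ∈ W, γ ≠ κ := fun γ hγ => ((hκα.trans (hWS γ hγ).2)).ne'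
  have hZT : ∀ γ ∈ W, ∀ β ∈ T, inner ℝ (Z γ) (v β) = 0 := fun γ hγ β hβ =>
    h.inner_of_lt γ (hWS γ hγ).1 (hWne γ hγ) β (hTS β hβ).1 (hTS β hβ).2.2
      ((hTS β hβ).2.1.trans (hWS γ hγ).2)
  have hinner_x : ∀ w : EuclideanSpace ℝ (Fin n), (∀ β ∈ T, inner ℝ w (v β) = 0) →
      inner ℝ w (intPoint x) = inner ℝ w (v κ) := by
    intro w hw
    rw [hx, intPoint_add, intPoint_sum_smul, inner_add_right, inner_sum, Finset.sum_eq_zero,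
      add_zero]
    intro β hβ
    rw [← Int.cast_smul_eq_zsmul ℝ, inner_smul_right, hw β hβ, mul_zero]
  obtain ⟨Y, f, hfx, hfT, hfW, hfn, hY⟩ := exists_dual_vectors_above (v := v) (Z := Z)
    (κ := κ) (κ' := κ') (T.erase κ') hf₀x hf₀T hf₀n hC (h.norm_le κ' hκ') W hWn
    (fun γ hγ => h.norm_le γ (hWS γ hγ).1)
    (fun γ hγ => h.inner_self γ (hWS γ hγ).1 (hWne γ hγ))
    (fun γ hγ β hβ => h.inner_of_lt γ (hWS γ hγ).1 (hWne γ hγ) β (hWS β hβ).1 (hWne β hβ))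
    (fun γ hγ β hβ => hZT γ hγ β (Finset.mem_of_mem_erase hβ))
    (fun γ hγ => hZT γ hγ κ' hκ'T)
    (fun γ hγ => hinner_x _ (hZT γ hγ))
    (fun γ hγ => h.dual_add_le γ (hWS γ hγ).1 (hκα.trans (hWS γ hγ).2))
  -- the new normal vector, before normalisation
  set s := inner ℝ u (v κ) with hs
  set w := u - s • f with hw
  have hux : inner ℝ u (intPoint x) = s := hinner_x u fun β hβ =>
    h.inner_normal β (hTS β hβ).1 (hTS β hβ).2.2
  have hwu : ‖w - u‖ ≤ 2 ^ n * Real.exp (-∑ β ∈ S', β) := by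
    have h1 : ‖f‖ ≤ 2 ^ n * (Real.exp α)⁻¹ := by
      refine hfn.trans ?_
      have : (2 : ℝ) ^ W.card ≤ 2 ^ n := pow_le_pow_right₀ one_le_two hWn
      gcongr
      have : 0 < (Real.exp α)⁻¹ := by positivity
      linarith
    have h2 := h.abs_inner_normal_le
    calc ‖w - u‖ = |s| * ‖f‖ := by
          rw [hw, sub_sub_cancel_left, norm_neg, norm_smul, Real.norm_eq_abs]
      _ ≤ Real.exp (κ - ∑ β ∈ S, β) * (2 ^ n * (Real.exp α)⁻¹) := by gcongr
      _ = 2 ^ n * Real.exp (-∑ β ∈ S', β) := by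
          rw [hsumS', ← Real.exp_neg, mul_left_comm, ← Real.exp_add]
          congr 2; ring
  have hw0 : w ≠ 0 := by
    intro h0
    rw [h0, zero_sub, norm_neg, h.norm_normal] at hwu
    have : 2 ^ n * Real.exp (-∑ β ∈ S', β) ≤ 2 ^ n * Real.exp (-δ) := by gcongr
    linarith
  set Z' : ℝ → EuclideanSpace ℝ (Fin n) := fun β =>
    if β < α then Z β else if β = α then f₀ else Y β with hZ'
  have hZ'T : ∀ β ∈ T, Z' β = Z β := fun β hβ => if_pos (hTS β hβ).2.1
  have hZ'α : Z' α = f₀ := by simp [hZ']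
  have hZ'W : ∀ β ∈ W, Z' β = Y β := fun β hβ => by
    have := (hWS β hβ).2
    simp [hZ', this.not_gt, this.ne']
  set X' := Function.update X α x with hX'
  have hX'α : X' α = x := Function.update_self _ _ _
  have hX'T : ∀ β ∈ T, X' β = X β := fun β hβ => Function.update_of_ne (hTS β hβ).2.1.ne _ _
  have hX'W : ∀ β ∈ W, X' β = X β := fun β hβ => Function.update_of_ne (hWS β hβ).2.ne' _ _
  suffices hmain : GoodSystem S' κ' X' Z' (‖w‖⁻¹ • w) ∧
      ‖‖w‖⁻¹ • w - u‖ ≤ 2 ^ (n + 1) * Real.exp (-∑ β ∈ S', β) from ⟨x, Z', _, hmain⟩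
  refine ⟨⟨hcardS', ?_, ?_, ?_, ?_, ?_, ?_, ?_, ?_, ?_⟩, ?_⟩
  · exact Finset.mem_insert_of_mem (Finset.mem_erase.2 ⟨hne, hκ'⟩)
  · intro β hβ
    rcases hS'mem β hβ with rfl | hβ | hβ
    · rwa [hX'α]
    · rw [hX'T β hβ]; exact h.norm_le β (hTS β hβ).1
    · rw [hX'W β hβ]; exact h.norm_le β (hWS β hβ).1
  · intro β hβ hβne
    rcases hS'mem β hβ with rfl | hβ | hβ
    · rwa [hX'α, hZ'α]
    · rw [hX'T β hβ, hZ'T β hβ]; exact h.inner_self β (hTS β hβ).1 (hTS β hβ).2.2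
    · rw [hX'W β hβ, hZ'W β hβ]; exact (hY β hβ).1
  · intro γ hγ hγne β hβ hβne hlt
    rcases hS'mem γ hγ with rfl | hγ | hγ
    · rcases hS'mem β hβ with rfl | hβ | hβ
      · exact absurd hlt (lt_irrefl _)
      · rw [hX'T β hβ, hZ'α]; exact hf₀T β (Finset.mem_erase.2 ⟨hβne, hβ⟩)
      · exact absurd hlt (hWS β hβ).2.not_gt
    · rcases hS'mem β hβ with rfl | hβ | hβ
      · exact absurd hlt (hTS γ hγ).2.1.not_gt
      · rw [hX'T β hβ, hZ'T γ hγ]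
        exact h.inner_of_lt γ (hTS γ hγ).1 (hTS γ hγ).2.2 β (hTS β hβ).1 (hTS β hβ).2.2 hlt
      · exact absurd hlt ((hTS γ hγ).2.1.trans (hWS β hβ).2).not_gt
    · rw [hZ'W γ hγ]
      rcases hS'mem β hβ with rfl | hβ | hβ
      · rw [hX'α]; exact (hY γ hγ).2.1
      · rw [hX'T β hβ]; exact (hY γ hγ).2.2.1 β (Finset.mem_erase.2 ⟨hβne, hβ⟩)
      · rw [hX'W β hβ]; exact (hY γ hγ).2.2.2.1 β hβ hlt
  · intro β hβ hβne
    rcases hS'mem β hβ with rfl | hβ | hβ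
    · rw [hZ'α]
      calc ‖f₀‖ * Real.exp β ≤ 16 / 23 * (Real.exp β)⁻¹ * Real.exp β := by gcongr
        _ ≤ 1 := by rw [mul_assoc, inv_mul_cancel₀ hE.ne']; norm_num
    · rw [hZ'T β hβ]; exact h.dual_le β (hTS β hβ).1 (hTS β hβ).2.2
    · rw [hZ'W β hβ]
      have h1 := (hY β hβ).2.2.2.2
      have h2 : 0 ≤ 1 / 8 * |inner ℝ (Y β) (v κ')| * Real.exp (β - κ') := by positivity
      linarith
  · intro β hβ hlt
    rw [hX'T κ' hκ'T]
    rcases hS'mem β hβ with rfl | hβ | hβ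
    · rw [hZ'α, Real.exp_sub]
      have h1 : |inner ℝ f₀ (intPoint (X κ'))| ≤ ‖f₀‖ * (7 / 4 * Real.exp κ') :=
        (abs_real_inner_le_norm _ _).trans
          (mul_le_mul_of_nonneg_left (h.norm_le κ' hκ') (norm_nonneg _))
      have hexp := Real.exp_pos κ'
      calc ‖f₀‖ * Real.exp β + 1 / 8 * |inner ℝ f₀ (intPoint (X κ'))| *
            (Real.exp β / Real.exp κ')
          ≤ ‖f₀‖ * Real.exp β + 1 / 8 * (‖f₀‖ * (7 / 4 * Real.exp κ')) *
            (Real.exp β / Real.exp κ') := by gcongr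
        _ = 39 / 32 * (‖f₀‖ * Real.exp β) := by field_simp; ring
        _ ≤ 39 / 32 * (16 / 23 * (Real.exp β)⁻¹ * Real.exp β) := by gcongr
        _ ≤ 1 := by rw [mul_assoc (16 / 23 : ℝ), inv_mul_cancel₀ hE.ne']; norm_num
    · rw [hZ'T β hβ, h.inner_of_lt β (hTS β hβ).1 (hTS β hβ).2.2 κ' hκ' hne hlt]
      simpa using h.dual_le β (hTS β hβ).1 (hTS β hβ).2.2
    · rw [hZ'W β hβ]; exact (hY β hβ).2.2.2.2
  · exact norm_smul_inv_norm (𝕜 := ℝ) hw0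
  · intro β hβ hβne
    rw [inner_smul_left]
    refine mul_eq_zero_of_right _ ?_
    rw [hw, inner_sub_left, inner_smul_left]
    rcases hS'mem β hβ with rfl | hβ | hβ
    · rw [hX'α, hux, hfx]; simp
    · rw [hX'T β hβ, h.inner_normal β (hTS β hβ).1 (hTS β hβ).2.2,
        show inner ℝ f (intPoint (X β)) = 0 from hfT β (Finset.mem_erase.2 ⟨hβne, hβ⟩)]
      simp
    · rw [hX'W β hβ, h.inner_normal β (hWS β hβ).1 (hWne β hβ),
        show inner ℝ f (intPoint (X β)) = 0 from hfW β hβ]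
      simp
  · intro e he heS'
    -- exchanging `α` for `κ` in the enumeration changes one row of the matrix
    have himage : Finset.univ.image e = S' := by
      refine Finset.eq_of_subset_of_card_le (Finset.image_subset_iff.2 fun i _ => heS' i) ?_
      rw [Finset.card_image_of_injective _ he, hcardS', Finset.card_univ, Fintype.card_fin]
    obtain ⟨i₀, -, hi₀⟩ := Finset.mem_image.1
      (himage.symm ▸ Finset.mem_insert_self α (S.erase κ) : α ∈ Finset.univ.image e)
    set e₀ := Function.update e i₀ κ with he₀
    have hother : ∀ i, i ≠ i₀ → e i ∈ S ∧ e i ≠ κ ∧ e i ≠ α := by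
      intro i hi
      have h1 : e i ≠ α := fun h' => hi (he (h'.trans hi₀.symm))
      obtain ⟨h2, h3⟩ := Finset.mem_erase.1 (Finset.mem_of_mem_insert_of_ne (heS' i) h1)
      exact ⟨h3, h2, h1⟩
    have he₀i₀ : e₀ i₀ = κ := Function.update_self _ _ _
    have he₀i : ∀ i, i ≠ i₀ → e₀ i = e i := fun i hi => Function.update_of_ne hi _ _
    have he₀S : ∀ i, e₀ i ∈ S := fun i => by
      by_cases hi : i = i₀
      · rw [hi, he₀i₀]; exact h.mem
      · rw [he₀i i hi]; exact (hother i hi).1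
    have he₀inj : Function.Injective e₀ := by
      intro i j hij
      by_cases hi : i = i₀ <;> by_cases hj : j = i₀
      · rw [hi, hj]
      · rw [hi, he₀i₀, he₀i j hj] at hij; exact absurd hij.symm (hother j hj).2.1
      · rw [hj, he₀i₀, he₀i i hi] at hij; exact absurd hij (hother i hi).2.1
      · rw [he₀i i hi, he₀i j hj] at hij; exact he hij
    have himage₀ : Finset.univ.image e₀ = S := by
      refine Finset.eq_of_subset_of_card_le (Finset.image_subset_iff.2 fun i _ => he₀S i) ?_
      rw [Finset.card_image_of_injective _ he₀inj, h.card_eq, Finset.card_univ, Fintype.card_fin]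
    set d : ℝ → ℤ := fun β => if β = κ then 1 else if β ∈ T then c β else 0 with hd
    have hxd : x = ∑ i, d (e₀ i) • X (e₀ i) := by
      have h1 : ∑ i, d (e₀ i) • X (e₀ i) = ∑ β ∈ S, d β • X β := by
        rw [← himage₀, Finset.sum_image he₀inj.injOn]
      rw [h1, ← Finset.add_sum_erase S _ h.mem, hx]
      congr 1
      · simp [hd]
      · symm
        have hsub : T ⊆ S.erase κ := fun β hβ => Finset.mem_erase.2 ⟨(hTS β hβ).2.2, (hTS β hβ).1⟩
        rw [← Finset.sum_subset hsub]
        · refine Finset.sum_congr rfl fun β hβ => ?_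
          simp [hd, hβ, (hTS β hβ).2.2]
        · intro β hβ hβT
          simp [hd, hβT, (Finset.mem_erase.1 hβ).1]
    have hmat : (Matrix.of fun i => X' (e i)) =
        (Matrix.of fun i => X (e₀ i)).updateRow i₀
          (∑ i, d (e₀ i) • (Matrix.of fun i => X (e₀ i)) i) := by
      ext i j
      by_cases hi : i = i₀
      · rw [hi, Matrix.updateRow_self]
        simp only [Matrix.of_apply]
        rw [hi₀, hX'α, hxd]
        rfl
      · rw [Matrix.updateRow_ne hi]
        simp only [Matrix.of_apply]
        rw [he₀i i hi, hX', Function.update_of_ne (hother i hi).2.2]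
    rw [hmat, Matrix.det_updateRow_sum, he₀i₀]
    simpa [hd] using h.abs_det e₀ he₀inj he₀S
  · refine (norm_normalize_sub_le h.norm_normal hw0).trans ?_
    rw [pow_succ]
    linarith

/-! ### The initial system -/

/-- The rows `N r • e_{r+1} + e_r`, with the row `e_n` inserted at position `k`. -/
def initialRows {n : ℕ} (k : Fin (n + 1)) (N : Fin n → ℤ) : Fin (n + 1) → Fin (n + 1) → ℤ :=
  Fin.insertNth (α := fun _ => Fin (n + 1) → ℤ) k (Pi.single (Fin.last n) 1)
    (fun r => Pi.single r.succ (N r) + Pi.single r.castSucc 1)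

lemma initialRows_self {n : ℕ} (k : Fin (n + 1)) (N : Fin n → ℤ) :
    initialRows k N k = Pi.single (Fin.last n) 1 := by
  simp [initialRows]

lemma initialRows_succAbove {n : ℕ} (k : Fin (n + 1)) (N : Fin n → ℤ) (r : Fin n) :
    initialRows k N (k.succAbove r) = Pi.single r.succ (N r) + Pi.single r.castSucc 1 := by
  simp [initialRows]

lemma abs_det_initialRows {n : ℕ} (k : Fin (n + 1)) (N : Fin n → ℤ) :
    |(Matrix.of (initialRows k N)).det| = 1 := by
  rw [Matrix.det_succ_row _ k, Finset.sum_eq_single (Fin.last n)]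
  · have htri : ((Matrix.of (initialRows k N)).submatrix k.succAbove
        (Fin.last n).succAbove).IsUpperTriangular := by
      intro r c hrc
      simp only [id] at hrc
      rw [Matrix.submatrix_apply, Matrix.of_apply, initialRows_succAbove, Fin.succAbove_last]
      have h1 : c.castSucc ≠ r.succ := fun h => by
        have := congrArg Fin.val h
        simp only [Fin.val_castSucc, Fin.val_succ] at this
        rw [Fin.lt_def] at hrc
        omega
      have h2 : c.castSucc ≠ r.castSucc := fun h => hrc.ne (Fin.castSucc_injective _ h)
      simp [h1, h2]
    have hdet : ((Matrix.of (initialRows k N)).submatrix k.succAbove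
        (Fin.last n).succAbove).det = 1 := by
      rw [Matrix.det_of_isUpperTriangular htri]
      refine Finset.prod_eq_one fun r _ => ?_
      rw [Matrix.submatrix_apply, Matrix.of_apply, initialRows_succAbove, Fin.succAbove_last]
      simp [Fin.castSucc_lt_succ.ne]
    rw [hdet, Matrix.of_apply, initialRows_self, Pi.single_eq_same, abs_mul, abs_mul, abs_pow]
    simp
  · intro j _ hj
    rw [Matrix.of_apply, initialRows_self, Pi.single_eq_of_ne hj]
    simp
  · simp

lemma exists_unit_orthogonal {n : ℕ} (w : Fin n → EuclideanSpace ℝ (Fin (n + 1))) :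
    ∃ u : EuclideanSpace ℝ (Fin (n + 1)), ‖u‖ = 1 ∧ ∀ r, inner ℝ u (w r) = 0 := by
  set K := Submodule.span ℝ (Set.range w) with hK
  have hne : Kᗮ ≠ ⊥ := by
    rw [Ne, Submodule.orthogonal_eq_bot_iff]
    intro htop
    have h1 : Module.finrank ℝ K ≤ n := (finrank_range_le_card w).trans_eq (Fintype.card_fin n)
    rw [htop, finrank_top, finrank_euclideanSpace_fin] at h1
    omega
  obtain ⟨u, hu, hu0⟩ := Submodule.exists_mem_ne_zero_of_ne_bot hne
  refine ⟨‖u‖⁻¹ • u, norm_smul_inv_norm (𝕜 := ℝ) hu0, fun r => ?_⟩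
  rw [inner_smul_left, real_inner_comm,
    (Submodule.mem_orthogonal _ _).1 hu _ (Submodule.subset_span ⟨r, rfl⟩), mul_zero]

/-- The points `N r • e_{r+1} + e_r` are nearly orthogonal, with dual vectors `e_{r+1} / N r`, and
`e_n` completes them to a basis of `ℤⁿ`. -/
theorem exists_goodSystem {n : ℕ} {a : Fin n → ℝ} (ha : StrictMono a)
    (ha4 : ∀ j, 4 ≤ Real.exp (a j)) (k : Fin n) :
    ∃ (X : ℝ → Fin n → ℤ) (Z : ℝ → EuclideanSpace ℝ (Fin n)) (u : EuclideanSpace ℝ (Fin n)),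
      GoodSystem (Finset.univ.image a) (a k) X Z u := by
  obtain _ | n := n
  · exact k.elim0
  set N : Fin n → ℤ := fun r => ⌈5 / 4 * Real.exp (a (k.succAbove r))⌉ with hN
  have hNle : ∀ r, 5 / 4 * Real.exp (a (k.succAbove r)) ≤ N r := fun r => Int.le_ceil _
  have hNlt : ∀ r, (N r : ℝ) < 5 / 4 * Real.exp (a (k.succAbove r)) + 1 :=
    fun r => Int.ceil_lt_add_one _
  have hNpos : ∀ r, (0 : ℝ) < N r := fun r => lt_of_lt_of_le (by positivity) (hNle r)
  set x := initialRows k N with hx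
  set z : Fin (n + 1) → EuclideanSpace ℝ (Fin (n + 1)) :=
    Fin.insertNth (α := fun _ => EuclideanSpace ℝ (Fin (n + 1))) k 0
      (fun r => EuclideanSpace.single r.succ ((N r : ℝ)⁻¹)) with hz
  have hzr : ∀ r, z (k.succAbove r) = EuclideanSpace.single r.succ ((N r : ℝ)⁻¹) := fun r => by
    simp [hz]
  have hinv : ∀ j, Function.invFun a (a j) = j := Function.leftInverse_invFun ha.injective
  obtain ⟨u, hu1, hu⟩ := exists_unit_orthogonal fun r => intPoint (x (k.succAbove r))
  have hmem : ∀ α ∈ Finset.univ.image a, ∃ j, a j = α := fun α hα => by simpa using hα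
  have hcases : ∀ α ∈ Finset.univ.image a, α ≠ a k → ∃ r, a (k.succAbove r) = α := by
    intro α hα hne
    obtain ⟨j, rfl⟩ := hmem α hα
    obtain ⟨r, rfl⟩ := Fin.exists_succAbove_eq (fun h : j = k => hne (by rw [h]))
    exact ⟨r, rfl⟩
  have hinner : ∀ r (y : Fin (n + 1) → ℤ),
      inner ℝ (z (k.succAbove r)) (intPoint y) = (N r : ℝ)⁻¹ * y r.succ := fun r y => by
    rw [hzr, EuclideanSpace.inner_single_left]
    simp [intPoint]
  have hznorm : ∀ r, ‖z (k.succAbove r)‖ * Real.exp (a (k.succAbove r)) ≤ 4 / 5 := fun r => by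
    rw [hzr, PiLp.norm_single, norm_inv, Real.norm_eq_abs, abs_of_pos (hNpos r),
      inv_mul_le_iff₀ (hNpos r)]
    linarith [hNle r]
  refine ⟨fun α => x (Function.invFun a α), fun α => z (Function.invFun a α), u,
    ?_, ?_, ?_, ?_, ?_, ?_, ?_, hu1, ?_, ?_⟩
  · rw [Finset.card_image_of_injective _ ha.injective]; simp
  · simp
  · intro α hα
    by_cases hk : α = a k
    · rw [hk, hinv, hx, initialRows_self]
      have h1 : intPoint (Pi.single (Fin.last n) (1 : ℤ)) =
          EuclideanSpace.single (Fin.last n) 1 := by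
        ext i; simp [intPoint, Pi.single_apply]
      rw [h1, PiLp.norm_single, norm_one]
      linarith [ha4 k]
    · obtain ⟨r, rfl⟩ := hcases α hα hk
      rw [hinv, hx, initialRows_succAbove, intPoint_add]
      have h1 : ∀ (i : Fin (n + 1)) (m : ℤ),
          intPoint (Pi.single i m) = EuclideanSpace.single i (m : ℝ) := fun i m => by
        ext j
        by_cases h : j = i <;> simp [intPoint, h]
      rw [h1, h1]
      refine (norm_add_le _ _).trans ?_
      rw [PiLp.norm_single, PiLp.norm_single, Real.norm_eq_abs,
        abs_of_pos (hNpos r)]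
      simp only [Int.cast_one, norm_one]
      linarith [hNlt r, ha4 (k.succAbove r)]
  · intro α hα hk
    obtain ⟨r, rfl⟩ := hcases α hα hk
    rw [hinv, hinner, hx, initialRows_succAbove]
    have : r.succ ≠ r.castSucc := Fin.castSucc_lt_succ.ne'
    simp [this, (hNpos r).ne']
  · intro α hα hk β hβ hkβ hlt
    obtain ⟨r, rfl⟩ := hcases α hα hk
    obtain ⟨s, rfl⟩ := hcases β hβ hkβ
    have hsr : s < r := (Fin.strictMono_succAbove k).lt_iff_lt.1 (ha.lt_iff_lt.1 hlt)
    rw [hinv, hinv, hinner, hx, initialRows_succAbove]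
    have h1 : r.succ ≠ s.succ := fun h => hsr.ne' (Fin.succ_injective _ h)
    have h2 : r.succ ≠ s.castSucc := fun h => by
      have := congrArg Fin.val h
      simp only [Fin.val_castSucc, Fin.val_succ] at this
      rw [Fin.lt_def] at hsr
      omega
    simp [h1, h2]
  · intro α hα hk
    obtain ⟨r, rfl⟩ := hcases α hα hk
    rw [hinv]
    linarith [hznorm r]
  · intro α hα hlt
    obtain ⟨r, rfl⟩ := hcases α hα hlt.ne'
    rw [hinv, hinv, hinner, hx, initialRows_self]
    have h1 : |(N r : ℝ)⁻¹ * ((Pi.single (Fin.last n) 1 : Fin (n + 1) → ℤ) r.succ : ℝ)|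
        ≤ (N r : ℝ)⁻¹ := by
      have hN0 : (0 : ℝ) ≤ (N r : ℝ)⁻¹ := inv_nonneg.2 (hNpos r).le
      rw [Pi.single_apply]
      split_ifs
      · simp [abs_of_nonneg hN0]
      · simpa using (hNpos r).le
    have h2 : (N r : ℝ)⁻¹ * Real.exp (a (k.succAbove r) - a k) ≤ 1 := by
      rw [inv_mul_le_iff₀ (hNpos r), Real.exp_sub, mul_one]
      refine (div_le_self (Real.exp_pos _).le (by linarith [ha4 k])).trans ?_
      linarith [hNle r, Real.exp_pos (a (k.succAbove r))]
    have h3 := mul_le_mul_of_nonneg_right h1 (Real.exp_pos (a (k.succAbove r) - a k)).le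
    linarith [hznorm r]
  · intro α hα hk
    obtain ⟨r, rfl⟩ := hcases α hα hk
    rw [hinv]
    exact hu r
  · intro e he heS
    choose σ hσ using fun i => hmem (e i) (heS i)
    have hσinj : Function.Injective σ := fun i j hij => he (by rw [← hσ i, ← hσ j, hij])
    set π := Equiv.ofBijective σ (Finite.injective_iff_bijective.1 hσinj) with hπ
    have hmat : (Matrix.of fun i => x (Function.invFun a (e i))) =
        (Matrix.of x).submatrix π id := by
      ext i j
      simp [hπ, ← hσ i, hinv]
    rw [hmat, Matrix.det_permute, abs_mul, abs_det_initialRows]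
    simp

/-! ### The sequence of systems attached to a canvas -/

lemma exists_omitCoord_eq {n : ℕ} (a : Fin n → ℝ) {j k : Fin n} (hjk : j ≠ k) :
    ∃ r, omitCoord a k r = a j := by
  rcases lt_or_gt_of_ne hjk with h | h
  · refine ⟨⟨j, by omega⟩, ?_⟩
    simp [omitCoord, h]
  · refine ⟨⟨j - 1, by omega⟩, ?_⟩
    have h' : (k : ℕ) < j := h
    have h1 : ¬ ((j : ℕ) - 1 < k) := by omega
    simp only [omitCoord, h1, if_false]
    congr 1
    ext
    simp only
    omega

lemma exists_eq_omitCoord {n : ℕ} (a : Fin n → ℝ) (k : Fin n) (r : Fin (n - 1)) :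
    ∃ j, j ≠ k ∧ a j = omitCoord a k r := by
  by_cases h : (r : ℕ) < k
  · exact ⟨⟨r, by omega⟩, fun h' => by simp [← h'] at h, by simp [omitCoord, h]⟩
  · exact ⟨⟨r + 1, by omega⟩, fun h' => by simp [← h'] at h, by simp [omitCoord, h]⟩

namespace Canvas

variable {n : ℕ} {δ : ℝ} (C : Canvas n δ) {i : ℕ}

/-- The set of coordinates of the point `a i`; they index the integer points of stage `i`. -/
noncomputable def points (i : ℕ) : Finset ℝ := Finset.univ.image (C.a i)

lemma coord_mem_points (j : Fin n) : C.a i j ∈ C.points i :=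
  Finset.mem_image_of_mem _ (Finset.mem_univ j)

lemma lt_of_succ_lt (h : ((i + 1 : ℕ) : ℕ∞) < C.s) : (i : ℕ∞) < C.s :=
  lt_of_le_of_lt (by exact_mod_cast Nat.le_succ i) h

lemma sum_points (h : (i : ℕ∞) < C.s) : ∑ β ∈ C.points i, β = C.switch i := by
  rw [points, Finset.sum_image (C.strictMono_a i h).injective.injOn, switch]

lemma mesh_le (h : (i : ℕ∞) < C.s) (j : Fin n) : δ ≤ C.a i j := by
  obtain ⟨m, hm, hj⟩ := C.multiple_a i h j
  rw [hj]
  have : (1 : ℝ) ≤ m := by exact_mod_cast hm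
  nlinarith [C.mesh_pos]

lemma mesh_le_switch (h : (i : ℕ∞) < C.s) : δ ≤ C.switch i :=
  (C.mesh_le h (C.k i)).trans (Finset.single_le_sum (f := C.a i)
    (fun j _ => C.mesh_pos.le.trans (C.mesh_le h j)) (Finset.mem_univ _))

lemma exists_coord_succ (h : ((i + 1 : ℕ) : ℕ∞) < C.s) {j : Fin n} (hj : j ≠ C.k i) :
    ∃ j', j' ≠ C.l (i + 1) ∧ C.a (i + 1) j' = C.a i j := by
  obtain ⟨r, hr⟩ := exists_omitCoord_eq (C.a i) hj
  obtain ⟨j', h1, h2⟩ := exists_eq_omitCoord (C.a (i + 1)) (C.l (i + 1)) r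
  exact ⟨j', h1, by rw [h2, ← C.omit_eq i h, hr]⟩

lemma exists_coord_of_succ (h : ((i + 1 : ℕ) : ℕ∞) < C.s) {j : Fin n} (hj : j ≠ C.l (i + 1)) :
    ∃ j', j' ≠ C.k i ∧ C.a i j' = C.a (i + 1) j := by
  obtain ⟨r, hr⟩ := exists_omitCoord_eq (C.a (i + 1)) hj
  obtain ⟨j', h1, h2⟩ := exists_eq_omitCoord (C.a i) (C.k i) r
  exact ⟨j', h1, by rw [h2, C.omit_eq i h, hr]⟩

lemma coord_k_add_le (h : ((i + 1 : ℕ) : ℕ∞) < C.s) :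
    C.a i (C.k i) + δ ≤ C.a (i + 1) (C.l (i + 1)) :=
  le_trans (add_le_add_left ((C.strictMono_a i (C.lt_of_succ_lt h)).monotone
    (C.k_le_l_succ i h)) δ) (C.add_mesh_le i h)

lemma coord_l_notMem (h : ((i + 1 : ℕ) : ℕ∞) < C.s) :
    C.a (i + 1) (C.l (i + 1)) ∉ C.points i := by
  intro hmem
  obtain ⟨j, -, hj⟩ := Finset.mem_image.1 hmem
  by_cases hjk : j = C.k i
  · have := C.coord_k_add_le h
    rw [← hj, hjk] at this
    linarith [C.mesh_pos]
  · obtain ⟨j', h1, h2⟩ := C.exists_coord_succ h hjk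
    exact h1 ((C.strictMono_a (i + 1) h).injective (h2.trans hj))

lemma points_succ (h : ((i + 1 : ℕ) : ℕ∞) < C.s) :
    C.points (i + 1) =
      insert (C.a (i + 1) (C.l (i + 1))) ((C.points i).erase (C.a i (C.k i))) := by
  ext β
  simp only [points, Finset.mem_image, Finset.mem_univ, true_and, Finset.mem_insert,
    Finset.mem_erase]
  constructor
  · rintro ⟨j, rfl⟩
    by_cases hj : j = C.l (i + 1)
    · exact Or.inl (by rw [hj])
    · obtain ⟨j', h1, h2⟩ := C.exists_coord_of_succ h hj
      refine Or.inr ⟨fun h3 => h1 ?_, j', h2⟩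
      exact (C.strictMono_a i (C.lt_of_succ_lt h)).injective (h2.trans h3)
  · rintro (rfl | ⟨h1, j, rfl⟩)
    · exact ⟨_, rfl⟩
    · obtain ⟨j', -, h2⟩ := C.exists_coord_succ h (fun h3 : j = C.k i => h1 (by rw [h3]))
      exact ⟨j', h2⟩

lemma switch_add_le (h : ((i + 1 : ℕ) : ℕ∞) < C.s) : C.switch i + δ ≤ C.switch (i + 1) := by
  rw [← C.sum_points h, ← C.sum_points (C.lt_of_succ_lt h), C.points_succ h,
    Finset.sum_insert (fun h' => C.coord_l_notMem h (Finset.mem_of_mem_erase h')),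
    Finset.sum_erase_eq_sub (C.coord_mem_points (C.k i))]
  linarith [C.coord_k_add_le h]

lemma switch_add_mul_le (r : ℕ) (h : ((i + r : ℕ) : ℕ∞) < C.s) :
    C.switch i + r * δ ≤ C.switch (i + r) := by
  induction r with
  | zero => simp
  | succ r ih =>
    have h1 := C.switch_add_le (i := i + r) h
    have h2 := ih (C.lt_of_succ_lt (i := i + r) h)
    rw [← add_assoc]
    push_cast
    linarith

/-- Distinct multiples of the mesh are at least `δ` apart. -/
lemma coord_add_le_of_lt (h : (i : ℕ∞) < C.s) {i' : ℕ} (h' : (i' : ℕ∞) < C.s) {j j' : Fin n}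
    (hlt : C.a i j < C.a i' j') : C.a i j + δ ≤ C.a i' j' := by
  obtain ⟨m, -, hm⟩ := C.multiple_a i h j
  obtain ⟨m', -, hm'⟩ := C.multiple_a i' h' j'
  rw [hm, hm'] at hlt ⊢
  have h1 : m < m' := by exact_mod_cast lt_of_mul_lt_mul_right hlt C.mesh_pos.le
  have h2 : (m : ℝ) + 1 ≤ m' := by exact_mod_cast h1
  nlinarith [C.mesh_pos]

lemma exists_goodSystem_succ (hδ : 2 ^ n * Real.exp (-δ) ≤ 1 / 400)
    (h : ((i + 1 : ℕ) : ℕ∞) < C.s) {X : ℝ → Fin n → ℤ} {Z : ℝ → EuclideanSpace ℝ (Fin n)}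
    {u : EuclideanSpace ℝ (Fin n)} (hG : GoodSystem (C.points i) (C.a i (C.k i)) X Z u) :
    ∃ (X' : ℝ → Fin n → ℤ) (Z' : ℝ → EuclideanSpace ℝ (Fin n)) (u' : EuclideanSpace ℝ (Fin n)),
      GoodSystem (C.points (i + 1)) (C.a (i + 1) (C.k (i + 1))) X' Z' u' ∧
      (∀ β ∈ C.points i, X' β = X β) ∧
      ‖u' - u‖ ≤ 2 ^ (n + 1) * Real.exp (-C.switch (i + 1)) := by
  have hi := C.lt_of_succ_lt h
  have hkl := C.k_lt_l (i + 1) (by omega) h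
  obtain ⟨j, hj, hja⟩ := C.exists_coord_of_succ h hkl.ne
  have hsum : δ ≤ ∑ β ∈ C.points (i + 1), β := by
    rw [C.sum_points h]; exact C.mesh_le_switch h
  obtain ⟨x, Z', u', h1, h2⟩ := hG.exists_step (α := C.a (i + 1) (C.l (i + 1)))
    (κ' := C.a (i + 1) (C.k (i + 1))) hδ (by linarith [C.coord_k_add_le h, C.mesh_pos])
    (fun β hβ hlt => by
      obtain ⟨r, -, rfl⟩ := Finset.mem_image.1 hβ
      exact C.coord_add_le_of_lt hi h hlt)
    (C.coord_l_notMem h) (Finset.mem_image.2 ⟨j, Finset.mem_univ _, hja⟩)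
    (fun h' => hj ((C.strictMono_a i hi).injective (hja.trans h')))
    (C.strictMono_a (i + 1) h hkl) (by rwa [← C.points_succ h])
  rw [← C.points_succ h, C.sum_points h] at h2
  rw [← C.points_succ h] at h1
  refine ⟨_, Z', u', h1, fun β hβ => Function.update_of_ne ?_ _ _, h2⟩
  rintro rfl
  exact C.coord_l_notMem h hβ

/-- A good system for each index of the canvas; past the last one the normal vectors are
constant. -/
lemma exists_goodSystem_seq (hδ : 2 ^ n * Real.exp (-δ) ≤ 1 / 400) :
    ∃ (X : ℕ → ℝ → Fin n → ℤ) (Z : ℕ → ℝ → EuclideanSpace ℝ (Fin n))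
      (u : ℕ → EuclideanSpace ℝ (Fin n)),
      (∀ i : ℕ, (i : ℕ∞) < C.s →
        GoodSystem (C.points i) (C.a i (C.k i)) (X i) (Z i) (u i)) ∧
      (∀ i : ℕ, ((i + 1 : ℕ) : ℕ∞) < C.s → (∀ β ∈ C.points i, X (i + 1) β = X i β) ∧
        ‖u (i + 1) - u i‖ ≤ 2 ^ (n + 1) * Real.exp (-C.switch (i + 1))) ∧
      ∀ i : ℕ, ¬ ((i + 1 : ℕ) : ℕ∞) < C.s → u (i + 1) = u i := by
  let St := (ℝ → Fin n → ℤ) × (ℝ → EuclideanSpace ℝ (Fin n)) × EuclideanSpace ℝ (Fin n)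
  let G : ℕ → St → Prop := fun i st =>
    GoodSystem (C.points i) (C.a i (C.k i)) st.1 st.2.1 st.2.2
  have hnext : ∀ (i : ℕ) (st : St), ∃ st' : St,
      (((i + 1 : ℕ) : ℕ∞) < C.s → G i st → G (i + 1) st' ∧
        (∀ β ∈ C.points i, st'.1 β = st.1 β) ∧
        ‖st'.2.2 - st.2.2‖ ≤ 2 ^ (n + 1) * Real.exp (-C.switch (i + 1))) ∧
      (¬ ((i + 1 : ℕ) : ℕ∞) < C.s → st'.2.2 = st.2.2) := by
    intro i st
    by_cases h : ((i + 1 : ℕ) : ℕ∞) < C.s ∧ G i st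
    · obtain ⟨X', Z', u', h'⟩ := C.exists_goodSystem_succ hδ h.1 h.2
      exact ⟨(X', Z', u'), fun _ _ => h', fun h'' => absurd h.1 h''⟩
    · exact ⟨st, fun h1 h2 => absurd ⟨h1, h2⟩ h, fun _ => rfl⟩
  choose next hnext1 hnext2 using hnext
  have h0 : ((0 : ℕ) : ℕ∞) < C.s := lt_of_lt_of_le (by simp) C.one_le_s
  have hexpδ : 4 ≤ Real.exp δ := by
    have h1 : Real.exp (-δ) ≤ 1 / 400 :=
      (le_mul_of_one_le_left (Real.exp_pos _).le (one_le_pow₀ one_le_two)).trans hδ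
    rw [Real.exp_neg, inv_le_comm₀ (Real.exp_pos _) (by norm_num)] at h1
    norm_num at h1
    linarith
  obtain ⟨X₀, Z₀, u₀, hG₀⟩ := exists_goodSystem (C.strictMono_a 0 h0)
    (fun j => hexpδ.trans (Real.exp_le_exp.2 (C.mesh_le h0 j))) (C.k 0)
  let seq : ℕ → St := fun i => Nat.rec (X₀, Z₀, u₀) next i
  have hG : ∀ i : ℕ, (i : ℕ∞) < C.s → G i (seq i) := by
    intro i
    induction i with
    | zero => exact fun _ => hG₀
    | succ i ih => exact fun h => (hnext1 i (seq i) h (ih (C.lt_of_succ_lt h))).1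
  exact ⟨fun i => (seq i).1, fun i => (seq i).2.1, fun i => (seq i).2.2, hG,
    fun i h => (hnext1 i (seq i) h (hG i (C.lt_of_succ_lt h))).2,
    fun i h => hnext2 i (seq i) h⟩

/-- The normal vectors of the systems converge to a unit vector `u`, so fast that the points of the
`i`-th system have, relative to `u`, the trajectories prescribed by the canvas on the interval
`[q_i, q_{i+1})`. -/
theorem exists_unit_vector (hδ : 2 ^ n * Real.exp (-δ) ≤ 1 / 400) :
    ∃ u : EuclideanSpace ℝ (Fin n), ‖u‖ = 1 ∧ ∀ i : ℕ, (i : ℕ∞) < C.s →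
      ∃ x : Fin n → Fin n → ℤ, LinearIndependent ℝ (fun j => intPoint (x j)) ∧
        (∀ j, ‖intPoint (x j)‖ ≤ 7 / 4 * Real.exp (C.a i j)) ∧
        |inner ℝ (intPoint (x (C.k i))) u| ≤ 2 * Real.exp (C.a i (C.k i) - C.switch i) ∧
        ∀ j, j ≠ C.k i →
          (((i + 1 : ℕ) : ℕ∞) < C.s →
            |inner ℝ (intPoint (x j)) u| ≤ 2 * Real.exp (C.a i j - C.switch (i + 1))) ∧
          (¬ ((i + 1 : ℕ) : ℕ∞) < C.s → inner ℝ (intPoint (x j)) u = 0) := by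
  obtain ⟨X, Z, u, hG, hstep, hlast⟩ := C.exists_goodSystem_seq hδ
  have hexp2 : Real.exp (-δ) ≤ 1 / 2 := by
    have h1 : Real.exp (-δ) ≤ 1 / 400 :=
      (le_mul_of_one_le_left (Real.exp_pos _).le (one_le_pow₀ one_le_two)).trans hδ
    linarith
  -- the mesh makes the distances decrease geometrically; ratio `1 / 2` is enough
  have hdist : ∀ i : ℕ, (i : ℕ∞) < C.s → ∀ r,
      dist (u (i + r)) (u (i + r + 1)) ≤ (1 / 200 * Real.exp (-C.switch i)) * (1 / 2) ^ r := by
    intro i hi r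
    by_cases h : ((i + r + 1 : ℕ) : ℕ∞) < C.s
    · rw [dist_comm, dist_eq_norm]
      refine (hstep _ h).2.trans ?_
      have h1 := C.switch_add_mul_le (i := i) (r + 1) h
      have h2 : Real.exp (-C.switch (i + r + 1)) ≤
          Real.exp (-C.switch i) * (Real.exp (-δ) * Real.exp (-δ) ^ r) := by
        rw [← pow_succ', ← Real.exp_nat_mul, ← Real.exp_add]
        refine Real.exp_le_exp.2 ?_
        rw [← add_assoc] at h1
        push_cast at h1 ⊢
        linarith
      have h3 : Real.exp (-δ) ^ r ≤ (1 / 2) ^ r :=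
        pow_le_pow_left₀ (Real.exp_pos _).le hexp2 r
      calc 2 ^ (n + 1) * Real.exp (-C.switch (i + r + 1))
          ≤ 2 ^ (n + 1) * (Real.exp (-C.switch i) * (Real.exp (-δ) * Real.exp (-δ) ^ r)) := by
            gcongr
        _ = 2 * (2 ^ n * Real.exp (-δ)) * Real.exp (-C.switch i) * Real.exp (-δ) ^ r := by ring
        _ ≤ 2 * (1 / 400) * Real.exp (-C.switch i) * (1 / 2) ^ r := by gcongr
        _ = _ := by ring
    · rw [hlast _ h, dist_self]
      positivity
  have h0 : ((0 : ℕ) : ℕ∞) < C.s := lt_of_lt_of_le (by simp) C.one_le_s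
  obtain ⟨v, hv⟩ : ∃ v, Filter.Tendsto u Filter.atTop (nhds v) :=
    cauchySeq_tendsto_of_complete (cauchySeq_of_le_geometric (1 / 2) _ (by norm_num)
      (fun r => by simpa using hdist 0 h0 r))
  have hclose : ∀ i : ℕ, (i : ℕ∞) < C.s → ‖v - u i‖ ≤ 1 / 100 * Real.exp (-C.switch i) := by
    intro i hi
    have hv' : Filter.Tendsto (fun r => u (i + r)) Filter.atTop (nhds v) := by
      simpa only [add_comm] using (Filter.tendsto_add_atTop_iff_nat i).2 hv
    have h1 := dist_le_of_le_geometric_of_tendsto₀ (1 / 2) _ (by norm_num) (hdist i hi) hv'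
    rw [dist_comm, dist_eq_norm] at h1
    refine h1.trans_eq ?_
    ring
  have hnorm : ∀ i, ‖u i‖ = 1 := by
    intro i
    induction i with
    | zero => exact (hG 0 h0).norm_normal
    | succ i ih =>
      by_cases h : ((i + 1 : ℕ) : ℕ∞) < C.s
      · exact (hG _ h).norm_normal
      · rw [hlast i h, ih]
  refine ⟨v, tendsto_nhds_unique hv.norm (by simp [hnorm]), fun i hi => ?_⟩
  have hGi := hG i hi
  have hinj := (C.strictMono_a i hi).injective
  have hmem : ∀ j, C.a i j ∈ C.points i := fun j => C.coord_mem_points j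
  -- passing from a normal of the sequence to the limit changes a product very little
  have hpass : ∀ (i' : ℕ), (i' : ℕ∞) < C.s → ∀ j,
      |inner ℝ (intPoint (X i (C.a i j))) v| ≤ |inner ℝ (u i') (intPoint (X i (C.a i j)))|
        + Real.exp (C.a i j - C.switch i') := by
    intro i' hi' j
    have h1 : inner ℝ (intPoint (X i (C.a i j))) v = inner ℝ (u i') (intPoint (X i (C.a i j)))
        + inner ℝ (intPoint (X i (C.a i j))) (v - u i') := by
      rw [inner_sub_right, real_inner_comm (u i')]; ring
    rw [h1]
    refine (abs_add_le _ _).trans (add_le_add_right ?_ _)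
    calc |inner ℝ (intPoint (X i (C.a i j))) (v - u i')|
        ≤ ‖intPoint (X i (C.a i j))‖ * ‖v - u i'‖ := abs_real_inner_le_norm _ _
      _ ≤ 7 / 4 * Real.exp (C.a i j) * (1 / 100 * Real.exp (-C.switch i')) := by
          gcongr
          · exact hGi.norm_le _ (hmem j)
          · exact hclose i' hi'
      _ = 7 / 400 * Real.exp (C.a i j - C.switch i') := by
          rw [sub_eq_add_neg, Real.exp_add]; ring
      _ ≤ _ := by linarith [Real.exp_pos (C.a i j - C.switch i')]
  refine ⟨fun j => X i (C.a i j), hGi.linearIndependent hinj hmem,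
    fun j => hGi.norm_le _ (hmem j), ?_, fun j hj => ⟨fun h => ?_, fun h => ?_⟩⟩
  · have h1 := hGi.abs_inner_normal_le
    rw [C.sum_points hi] at h1
    linarith [hpass i hi (C.k i)]
  -- the point is still present at the next stage: it is orthogonal to the next normal vector,
  -- unless it is the point removed there. Comparing with `u i` instead would lose a factor `2 ^ n`
  · have hG' := hG _ h
    have h1 : |inner ℝ (u (i + 1)) (intPoint (X i (C.a i j)))| ≤
        Real.exp (C.a i j - C.switch (i + 1)) := by
      obtain ⟨j', -, hj'⟩ := C.exists_coord_succ h hj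
      rw [← (hstep i h).1 _ (hmem j)]
      by_cases hk : C.a i j = C.a (i + 1) (C.k (i + 1))
      · rw [hk, ← C.sum_points h]
        exact hG'.abs_inner_normal_le
      · rw [hG'.inner_normal _ (Finset.mem_image.2 ⟨j', Finset.mem_univ _, hj'⟩) hk, abs_zero]
        exact (Real.exp_pos _).le
    linarith [hpass (i + 1) h j]
  · have hconst : ∀ r, u (i + r) = u i := by
      intro r
      induction r with
      | zero => rfl
      | succ r ih =>
        rw [← add_assoc, hlast (i + r) (fun h' => h (lt_of_le_of_lt ?_ h')), ih]
        exact_mod_cast (by omega : i + 1 ≤ i + r + 1)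
    have hv' : Filter.Tendsto (fun r => u (i + r)) Filter.atTop (nhds v) := by
      simpa only [add_comm] using (Filter.tendsto_add_atTop_iff_nat i).2 hv
    simp only [hconst] at hv'
    rw [← tendsto_nhds_unique tendsto_const_nhds hv', real_inner_comm]
    exact hGi.inner_normal _ (hmem j) (fun h' => hj (hinj h'))

end Canvas

/-! ### Comparison with the successive minima -/

lemma mem_smul_convexBody_iff {n : ℕ} {u x : EuclideanSpace ℝ (Fin n)} {Q c : ℝ} (hc : 0 < c) :
    (∃ y ∈ convexBody u Q, c • y = x) ↔ ‖x‖ ≤ c ∧ |inner ℝ x u| ≤ c * Q⁻¹ := by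
  constructor
  · rintro ⟨y, ⟨h1, h2⟩, rfl⟩
    rw [norm_smul, inner_smul_left, abs_mul, Real.norm_eq_abs, abs_of_pos hc]
    refine ⟨mul_le_of_le_one_right hc.le h1, ?_⟩
    simpa [abs_of_pos hc] using mul_le_mul_of_nonneg_left h2 hc.le
  · rintro ⟨h1, h2⟩
    refine ⟨c⁻¹ • x, ⟨?_, ?_⟩, smul_inv_smul₀ hc.ne' x⟩
    · rw [norm_smul, norm_inv, Real.norm_eq_abs, abs_of_pos hc, inv_mul_le_iff₀ hc, mul_one]
      exact h1
    · rw [inner_smul_left, abs_mul]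
      simp only [map_inv₀, conj_trivial, abs_inv, abs_of_pos hc]
      rwa [inv_mul_le_iff₀ hc]

lemma mem_admissibleExponents_iff {n : ℕ} {u : EuclideanSpace ℝ (Fin n)} {j : ℕ} {q L : ℝ} :
    L ∈ admissibleExponents u j q ↔ 0 ≤ L ∧ ∃ x : Fin j → (Fin n → ℤ),
      LinearIndependent ℝ (fun m => intPoint (x m)) ∧
      ∀ m, ‖intPoint (x m)‖ ≤ Real.exp L ∧
        |inner ℝ (intPoint (x m)) u| ≤ Real.exp L * (Real.exp q)⁻¹ := by
  refine and_congr_right fun _ => exists_congr fun x => and_congr_right fun _ =>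
    forall_congr' fun m => ?_
  rw [← mem_smul_convexBody_iff (Real.exp_pos L)]
  rfl

lemma minimaMap_le {n : ℕ} {u : EuclideanSpace ℝ (Fin n)} {q L : ℝ} {j : Fin n}
    (h : L ∈ admissibleExponents u (j + 1) q) : minimaMap u q j ≤ L :=
  csInf_le ⟨0, fun _ hL => hL.1⟩ h

/-- Points realising the successive minima up to `ε` can be chosen linearly independent: at each
level some admissible point lies outside the span of the points already chosen. -/
lemma exists_linearIndependent_near_minima {n : ℕ} {u : EuclideanSpace ℝ (Fin n)} {q ε : ℝ}
    (hε : 0 < ε) (hne : ∀ j : Fin n, (admissibleExponents u (j + 1) q).Nonempty)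
    (m : ℕ) (hm : m ≤ n) :
    ∃ y : Fin m → (Fin n → ℤ), LinearIndependent ℝ (fun i => intPoint (y i)) ∧
      ∀ i : Fin m, ‖intPoint (y i)‖ ≤ Real.exp (minimaMap u q (Fin.castLE hm i) + ε) ∧
        |inner ℝ (intPoint (y i)) u|
          ≤ Real.exp (minimaMap u q (Fin.castLE hm i) + ε) * (Real.exp q)⁻¹ := by
  induction m with
  | zero => exact ⟨Fin.elim0, linearIndependent_empty_type, fun i => i.elim0⟩
  | succ m ih =>
    obtain ⟨y, hy, hyb⟩ := ih (by omega)
    obtain ⟨L, hL, hLlt⟩ := exists_lt_of_csInf_lt (hne ⟨m, hm⟩)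
      (lt_add_of_pos_right (minimaMap u q ⟨m, hm⟩) hε)
    obtain ⟨-, x, hx, hxb⟩ := mem_admissibleExponents_iff.1 hL
    obtain ⟨i, hi⟩ : ∃ i, intPoint (x i) ∉
        Submodule.span ℝ (Set.range fun i => intPoint (y i)) := by
      by_contra! hall
      have h1 : Submodule.span ℝ (Set.range fun i => intPoint (x i))
          ≤ Submodule.span ℝ (Set.range fun i => intPoint (y i)) :=
        Submodule.span_le.2 (by rintro _ ⟨i, rfl⟩; exact hall i)
      have h2 := Submodule.finrank_mono h1
      rw [finrank_span_eq_card hx, finrank_span_eq_card hy] at h2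
      simp at h2
    refine ⟨Fin.snoc (α := fun _ => Fin n → ℤ) y (x i), ?_, fun r => ?_⟩
    · have h3 : (fun r => intPoint ((Fin.snoc (α := fun _ => Fin n → ℤ) y (x i) :
          Fin (m + 1) → Fin n → ℤ) r)) =
          Fin.snoc (α := fun _ => EuclideanSpace ℝ (Fin n)) (fun r => intPoint (y r))
            (intPoint (x i)) := by
        funext r
        induction r using Fin.lastCases <;> simp
      rw [h3]
      exact linearIndependent_finSnoc.2 ⟨hy, hi⟩
    · induction r using Fin.lastCases with
      | cast r => simpa using hyb r
      | last =>
        rw [Fin.snoc_last]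
        have hle : Real.exp L ≤ Real.exp (minimaMap u q (Fin.castLE hm (Fin.last m)) + ε) :=
          Real.exp_le_exp.2 hLlt.le
        refine ⟨(hxb i).1.trans hle, (hxb i).2.trans ?_⟩
        exact mul_le_mul_of_nonneg_right hle (inv_nonneg.2 (Real.exp_pos q).le)

/-- The easy half of Minkowski's second theorem for the bodies `C_u(e^q)`. -/
lemma le_sum_minimaMap {n : ℕ} {u : EuclideanSpace ℝ (Fin n)} (hu : ‖u‖ = 1) {q : ℝ}
    (hne : ∀ j : Fin n, (admissibleExponents u (j + 1) q).Nonempty) :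
    q ≤ ∑ j, minimaMap u q j + n * Real.log (Real.sqrt 2) := by
  refine le_of_forall_pos_le_add fun ε hε => ?_
  have hn : (0 : ℝ) < n + 1 := by positivity
  obtain ⟨y, hy, hyb⟩ := exists_linearIndependent_near_minima (div_pos hε hn) hne n le_rfl
  have h := le_prod_of_linearIndependent_mem hu (Real.exp_pos q) y hy _ (fun i => (hyb i).1)
    (fun i => (hyb i).2)
  have h2 : (0 : ℝ) < Real.sqrt 2 := by positivity
  have hlog := Real.log_le_log (Real.exp_pos q) h
  rw [Real.log_exp, Real.log_prod (fun i _ => (mul_pos h2 (Real.exp_pos _)).ne')] at hlog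
  simp only [Real.log_mul h2.ne' (Real.exp_pos _).ne', Real.log_exp, Fin.castLE_rfl, id,
    Finset.sum_add_distrib, Finset.sum_const, Finset.card_univ, Fintype.card_fin,
    nsmul_eq_mul] at hlog
  have : n * (ε / (n + 1)) ≤ ε := by
    rw [← mul_div_assoc, div_le_iff₀ hn]; nlinarith
  linarith

/-- If suitable points bound each successive minimum from above by `b j + c`, where `b` has sum
`q`, then the lower bound on the sum of the minima bounds each of them from below. -/
lemma norm_sortCoords_sub_minimaMap_le {n : ℕ} {u : EuclideanSpace ℝ (Fin n)} (hu : ‖u‖ = 1)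
    {q c : ℝ} (hc : 0 ≤ c) {b : Fin n → ℝ} (hb : ∀ j, 0 ≤ b j) (hbq : ∑ j, b j = q)
    (x : Fin n → Fin n → ℤ) (hx : LinearIndependent ℝ (fun j => intPoint (x j)))
    (h1 : ∀ j, ‖intPoint (x j)‖ ≤ Real.exp (b j + c))
    (h2 : ∀ j, |inner ℝ (intPoint (x j)) u| ≤ Real.exp (b j + c) * (Real.exp q)⁻¹) :
    ‖sortCoords b - minimaMap u q‖ ≤ n * (c + Real.log (Real.sqrt 2)) := by
  set P := sortCoords b with hP
  have hmono : Monotone P := Tuple.monotone_sort b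
  have hadm : ∀ j : Fin n, P j + c ∈ admissibleExponents u (j + 1) q := by
    intro j
    rw [mem_admissibleExponents_iff]
    refine ⟨add_nonneg (hb _) hc, fun m => x (Tuple.sort b (Fin.castLE (by omega) m)), ?_, ?_⟩
    · exact hx.comp (fun m : Fin (j + 1) => Tuple.sort b (Fin.castLE (by omega) m))
        ((Tuple.sort b).injective.comp (Fin.castLE_injective (by omega : (j : ℕ) + 1 ≤ n)))
    · intro m
      have hle : Real.exp (b (Tuple.sort b (Fin.castLE (by omega) m)) + c) ≤
          Real.exp (P j + c) := by
        refine Real.exp_le_exp.2 (add_le_add_left (hmono ?_) c)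
        rw [Fin.le_def, Fin.val_castLE]
        omega
      refine ⟨(h1 _).trans hle, (h2 _).trans ?_⟩
      exact mul_le_mul_of_nonneg_right hle (inv_nonneg.2 (Real.exp_pos q).le)
  have hup : ∀ j, minimaMap u q j ≤ P j + c := fun j => minimaMap_le (hadm j)
  have hPq : ∑ j, P j = q := by rw [← hbq]; exact Equiv.sum_comp (Tuple.sort b) b
  have hlow := le_sum_minimaMap hu fun j => ⟨_, hadm j⟩
  have hs2 : 0 ≤ Real.log (Real.sqrt 2) := Real.log_nonneg (by
    rw [Real.one_le_sqrt]; norm_num)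
  have hn0 : (0 : ℝ) ≤ n := Nat.cast_nonneg n
  refine (pi_norm_le_iff_of_nonneg (by positivity)).2 fun j => ?_
  have hn1 : (1 : ℝ) ≤ n := by exact_mod_cast j.pos
  rw [Pi.sub_apply, Real.norm_eq_abs, abs_le]
  constructor
  · have : c ≤ n * (c + Real.log (Real.sqrt 2)) := by nlinarith [mul_nonneg hn0 hs2]
    linarith [hup j]
  · have h3 : ∑ r, (P r - minimaMap u q r) ≤ n * Real.log (Real.sqrt 2) := by
      rw [Finset.sum_sub_distrib, hPq]; linarith
    have h4 : P j - minimaMap u q j + c ≤ ∑ r, (P r - minimaMap u q r + c) :=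
      Finset.single_le_sum (f := fun r => P r - minimaMap u q r + c)
        (fun r _ => by linarith [hup r]) (Finset.mem_univ j)
    rw [Finset.sum_add_distrib, Finset.sum_const, Finset.card_univ, Fintype.card_fin,
      nsmul_eq_mul] at h4
    linarith

/-! ### Rigid systems -/

namespace Canvas

lemma exists_switch_le_lt {n : ℕ} {δ : ℝ} (C : Canvas n δ) {q : ℝ} (hq : C.switch 0 ≤ q) :
    ∃ i : ℕ, (i : ℕ∞) < C.s ∧ C.switch i ≤ q ∧
      (((i + 1 : ℕ) : ℕ∞) < C.s → q < C.switch (i + 1)) := by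
  by_contra! hcon
  have hall : ∀ i : ℕ, (i : ℕ∞) < C.s ∧ C.switch i ≤ q := by
    intro i
    induction i with
    | zero => exact ⟨lt_of_lt_of_le (by simp) C.one_le_s, hq⟩
    | succ i ih => exact hcon i ih.1 ih.2
  obtain ⟨r, hr⟩ := exists_nat_gt ((q - C.switch 0) / δ)
  rw [div_lt_iff₀ C.mesh_pos] at hr
  have h1 := C.switch_add_mul_le (i := 0) r (by simpa using (hall r).1)
  rw [zero_add] at h1
  linarith [(hall r).2]

end Canvas

lemma two_pow_mul_exp_neg_le {n : ℕ} {δ : ℝ} (hδ : 4 + ((n : ℝ) + 3) * Real.log 2 ≤ δ) :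
    2 ^ n * Real.exp (-δ) ≤ 1 / 400 := by
  have h1 : (50 : ℝ) ≤ Real.exp 4 := by
    have h := Real.exp_one_gt_d9
    have h2 : Real.exp 4 = Real.exp 1 ^ 4 := by rw [← Real.exp_nat_mul]; norm_num
    rw [h2]
    calc (50 : ℝ) ≤ 2.7 ^ 4 := by norm_num
      _ ≤ Real.exp 1 ^ 4 := pow_le_pow_left₀ (by norm_num) (by linarith) 4
  have h2 : Real.exp 4 * 2 ^ (n + 3) ≤ Real.exp δ := by
    refine le_trans (le_of_eq ?_) (Real.exp_le_exp.2 hδ)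
    rw [Real.exp_add, mul_comm _ (Real.log 2), Real.exp_mul, Real.exp_log two_pos]
    norm_cast
  rw [Real.exp_neg, ← div_eq_mul_inv, div_le_iff₀ (Real.exp_pos δ)]
  have h3 : (0 : ℝ) < 2 ^ n := by positivity
  rw [pow_add] at h2
  nlinarith

lemma log_four_add_log_sqrt_two_le {n : ℕ} (hn : 1 ≤ n) :
    Real.log 4 + Real.log (Real.sqrt 2) ≤ Real.log (8 * Real.exp 4 * (n : ℝ)) := by
  rw [← Real.log_mul (by norm_num) (by positivity)]
  refine Real.log_le_log (by positivity) ?_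
  have h1 : Real.sqrt 2 ≤ 2 := by rw [Real.sqrt_le_left] <;> norm_num
  have h2 : (1 : ℝ) ≤ Real.exp 4 * n :=
    one_le_mul_of_one_le_of_one_le (Real.one_le_exp (by norm_num)) (by exact_mod_cast hn)
  linarith

end RigidSystem

theorem mainTheorem5 (n : ℕ) (hn : 2 ≤ n) (δ : ℝ)
    (hδ : 4 + ((n : ℝ) + 3) * Real.log 2 ≤ δ)
    (q₀ : ℝ) (P : ℝ → Fin n → ℝ) (hP : RigidSystem.IsRigidSystem n δ q₀ P) :
    ∃ u : EuclideanSpace ℝ (Fin n), ‖u‖ = 1 ∧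
      ∀ q : ℝ, q₀ ≤ q →
        ‖P q - RigidSystem.minimaMap u q‖ ≤ (n : ℝ) * Real.log (8 * Real.exp 4 * (n : ℝ)) := by
  obtain ⟨C, rfl, hP⟩ := hP
  obtain ⟨u, hu, hux⟩ := C.exists_unit_vector (RigidSystem.two_pow_mul_exp_neg_le hδ)
  refine ⟨u, hu, fun q hq => ?_⟩
  obtain ⟨i, hi, hiq, hqi⟩ := C.exists_switch_le_lt hq
  obtain ⟨x, hx, hxn, hxk, hxj⟩ := hux i hi
  rw [hP i hi q hiq hqi]
  set b := Function.update (C.a i) (C.k i) (C.a i (C.k i) + q - C.switch i) with hb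
  have hbk : b (C.k i) = C.a i (C.k i) + q - C.switch i := Function.update_self _ _ _
  have hbj : ∀ j, j ≠ C.k i → b j = C.a i j := fun j hj => Function.update_of_ne hj _ _
  have hab : ∀ j, C.a i j ≤ b j := fun j => by
    by_cases hj : j = C.k i
    · rw [hj, hbk]; linarith
    · rw [hbj j hj]
  have hbq : ∑ j, b j = q := by
    rw [hb, Finset.sum_update_of_mem (Finset.mem_univ _), Finset.sdiff_singleton_eq_erase,
      Finset.sum_erase_eq_sub (Finset.mem_univ _), RigidSystem.Canvas.switch]
    ring
  have h4 : ∀ j, Real.exp (b j + Real.log 4) = 4 * Real.exp (b j) := fun j => by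
    rw [Real.exp_add, Real.exp_log (by norm_num), mul_comm]
  refine (RigidSystem.norm_sortCoords_sub_minimaMap_le hu
    (Real.log_nonneg (by norm_num : (1 : ℝ) ≤ 4))
    (fun j => C.mesh_pos.le.trans ((C.mesh_le hi j).trans (hab j))) hbq x hx
    (fun j => ?_) (fun j => ?_)).trans
    (mul_le_mul_of_nonneg_left (RigidSystem.log_four_add_log_sqrt_two_le (by omega))
      (Nat.cast_nonneg n))
  · rw [h4]
    have := Real.exp_le_exp.2 (hab j)
    linarith [hxn j, Real.exp_pos (C.a i j)]
  · rw [h4, mul_assoc, ← Real.exp_neg, ← Real.exp_add]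
    by_cases hj : j = C.k i
    · rw [hj, hbk]
      rw [show C.a i (C.k i) + q - C.switch i + -q = C.a i (C.k i) - C.switch i by ring]
      linarith [Real.exp_pos (C.a i (C.k i) - C.switch i)]
    · rw [hbj j hj]
      by_cases hlast : ((i + 1 : ℕ) : ℕ∞) < C.s
      · have h5 : Real.exp (C.a i j - C.switch (i + 1)) ≤ Real.exp (C.a i j + -q) :=
          Real.exp_le_exp.2 (by linarith [hqi hlast])
        linarith [(hxj j hj).1 hlast, Real.exp_pos (C.a i j + -q)]
      · rw [(hxj j hj).2 hlast, abs_zero]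
        positivity
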